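/- Let $n\ge 2$ and let $M$ be a (non-empty) smooth $n$-dimensional manifold with a Lorentzian metric $g$ (signature $(-,+,\dots,+)$), Levi-Civita connection $\nabla$, Ricci tensor $S(F,G)=\operatorname{trace}\{E\mapsto R(E,F)G\}$, where $R(E,F)G=\nabla_E\nabla_FG-\nabla_F\nabla_EG-\nabla_{[E,F]}G$, and scalar curvature $r=\operatorname{trace}_g S$. Suppose that $(M,g)$ is an LP-Kenmotsu (Lorentzian para-Kenmotsu) manifold, i.e. that there are a smooth $(1,1)$-tensor field $\varphi$, a smooth vector field $\zeta$ and a smooth $1$-form $\nu$ such that for all vector fields $E,F$ $$\nu(\zeta)=-1,\quad \varphi^2E=E+\nu(E)\zeta,\quad \varphi\zeta=0,\quad \nu(\varphi E)=0,$$ $$g(\varphi E,\varphi F)=g(E,F)+\nu(E)\nu(F),\quad g(E,\zeta)=\nu(E),\quad g(E,\varphi F)=g(F,\varphi E),$$ $$(\nabla_E\varphi)F=-g(\varphi E,F)\zeta-\nu(F)\varphi E .$$ Suppose that $r$ is constant on $M$, and that $(g,K,\Lambda,\sigma,\rho)$ is a Ricci-Yamabe soliton, i.e. that $K$ is a smooth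 vector field on $M$ and $\Lambda,\sigma,\rho\in\mathbb R$ are constants with $$\pounds_Kg+2\sigma S+(2\Lambda-\rho r)g=0 .$$ Then $$\Lambda=\frac{\rho\,n(n-1)}{2}-\sigma(n-1).$$ -/

import Mathlib

open scoped Manifold ContDiff

noncomputable section

namespace LPK

/-- The model space `ℝⁿ`, in which the coordinates of an `n`-dimensional manifold take values. -/
abbrev Vec (n : ℕ) : Type := EuclideanSpace ℝ (Fin n)

/-- The `i`-th coordinate vector `∂ᵢ` of `ℝⁿ`. -/
abbrev stdVec {n : ℕ} (i : Fin n) : Vec n := EuclideanSpace.single i (1 : ℝ)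

/-! ### Tensor calculus in one coordinate system

A field of bilinear forms on (an open subset of) `ℝⁿ` is a map `G : ℝⁿ → (ℝⁿ →L ℝⁿ →L ℝ)`; vectors
`u v w` stand for constant vector fields, so `fderiv ℝ G y u v w = ∂_u (G(v, w))` at `y`. -/

namespace Coord

variable {n : ℕ}

/-- The covector `G♭(Γ(u, v))`, that is
`w ↦ ½ (∂_u G(v, w) + ∂_v G(u, w) - ∂_w G(u, v))` (Christoffel symbols of the first kind). -/
def christoffelLower (G : Vec n → Vec n →L[ℝ] Vec n →L[ℝ] ℝ) (y u v : Vec n) : Vec n →L[ℝ] ℝ :=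
  (1 / 2 : ℝ) • (fderiv ℝ G y u v + fderiv ℝ G y v u - ((fderiv ℝ G y).flip u).flip v)

/-- The Christoffel symbols `Γ(u, v) = uⁱ vʲ Γᵏᵢⱼ ∂ₖ` of the Levi-Civita connection of `G`:
`∇_u v` for the constant fields `u`, `v`. Here `(G y).inverse` raises the index. -/
def christoffel (G : Vec n → Vec n →L[ℝ] Vec n →L[ℝ] ℝ) (y u v : Vec n) : Vec n :=
  (G y).inverse (christoffelLower G y u v)

/-- The covariant derivative `(∇_u Φ) v` of a `(1,1)`-tensor field `Φ` with respect to the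
Levi-Civita connection of `G`. -/
def covDerivEnd (G : Vec n → Vec n →L[ℝ] Vec n →L[ℝ] ℝ) (Φ : Vec n → Vec n →L[ℝ] Vec n)
    (y u v : Vec n) : Vec n :=
  fderiv ℝ Φ y u v + christoffel G y u (Φ y v) - Φ y (christoffel G y u v)

/-- The curvature tensor `R(u, v)w = ∇_u ∇_v w - ∇_v ∇_u w - ∇_{[u, v]} w` of `G`. -/
def curvature (G : Vec n → Vec n →L[ℝ] Vec n →L[ℝ] ℝ) (y u v w : Vec n) : Vec n :=
  fderiv ℝ (fun z ↦ christoffel G z v w) y u - fderiv ℝ (fun z ↦ christoffel G z u w) y v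
    + christoffel G y u (christoffel G y v w) - christoffel G y v (christoffel G y u w)

/-- The Ricci tensor `S(v, w) = trace (u ↦ R(u, v)w)` of `G`. -/
def ricci (G : Vec n → Vec n →L[ℝ] Vec n →L[ℝ] ℝ) (y v w : Vec n) : ℝ :=
  ∑ i : Fin n, curvature G y (stdVec i) v w i

/-- The components `gʲᵏ` of the inverse of `G`. -/
def inverseMetric (G : Vec n → Vec n →L[ℝ] Vec n →L[ℝ] ℝ) (y : Vec n) (j k : Fin n) : ℝ :=
  (G y).inverse (EuclideanSpace.proj j) k

/-- The scalar curvature `r = gʲᵏ Sⱼₖ` of `G`. -/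
def scalarCurvature (G : Vec n → Vec n →L[ℝ] Vec n →L[ℝ] ℝ) (y : Vec n) : ℝ :=
  ∑ j : Fin n, ∑ k : Fin n, inverseMetric G y j k * ricci G y (stdVec j) (stdVec k)

/-- The Lie derivative `(£_K G)(u, v)` of `G` along the vector field `K`. -/
def lieDeriv (G : Vec n → Vec n →L[ℝ] Vec n →L[ℝ] ℝ) (K : Vec n → Vec n) (y u v : Vec n) : ℝ :=
  fderiv ℝ G y (K y) u v + G y (fderiv ℝ K y u) v + G y u (fderiv ℝ K y v)

end Coord

/-! ### Tensor fields on a manifold and their coordinate expressions -/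

variable {n : ℕ} {M : Type*} [TopologicalSpace M] [ChartedSpace (Vec n) M]

/-- Coordinates of the manifold around `p`: the coordinate frame at the point with coordinates `y`,
i.e. the differential `ℝⁿ → T_x M` of the inverse of the chart at `p`. -/
def frame (p : M) (y : Vec n) :
    Vec n →L[ℝ] TangentSpace (𝓡 n) ((extChartAt (𝓡 n) p).symm y) :=
  mfderiv (𝓡 n) (𝓡 n) (extChartAt (𝓡 n) p).symm y

/-- Coordinate expression, in the chart at `p`, of a vector field. -/
def coordVec (X : ∀ x : M, TangentSpace (𝓡 n) x) (p : M) (y : Vec n) : Vec n :=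
  (frame p y).inverse (X ((extChartAt (𝓡 n) p).symm y))

/-- Coordinate expression, in the chart at `p`, of a `1`-form. -/
def coordForm (ν : ∀ x : M, TangentSpace (𝓡 n) x →L[ℝ] ℝ) (p : M) (y : Vec n) : Vec n →L[ℝ] ℝ :=
  (ν ((extChartAt (𝓡 n) p).symm y)).comp (frame p y)

/-- Coordinate expression, in the chart at `p`, of a `(1,1)`-tensor field. -/
def coordEnd (φ : ∀ x : M, TangentSpace (𝓡 n) x →L[ℝ] TangentSpace (𝓡 n) x) (p : M) (y : Vec n) :
    Vec n →L[ℝ] Vec n :=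
  (frame p y).inverse.comp ((φ ((extChartAt (𝓡 n) p).symm y)).comp (frame p y))

/-- Coordinate expression, in the chart at `p`, of a field of bilinear forms. -/
def coordBilin (g : ∀ x : M, TangentSpace (𝓡 n) x →L[ℝ] TangentSpace (𝓡 n) x →L[ℝ] ℝ)
    (p : M) (y : Vec n) : Vec n →L[ℝ] Vec n →L[ℝ] ℝ :=
  (ContinuousLinearMap.precomp ℝ (frame p y)).comp
    ((g ((extChartAt (𝓡 n) p).symm y)).comp (frame p y))

theorem coordBilin_apply (g : ∀ x : M, TangentSpace (𝓡 n) x →L[ℝ] TangentSpace (𝓡 n) x →L[ℝ] ℝ)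
    (p : M) (y u v : Vec n) :
    coordBilin g p y u v = g ((extChartAt (𝓡 n) p).symm y) (frame p y u) (frame p y v) :=
  rfl

variable [IsManifold (𝓡 n) ∞ M]

/-- `X` is a smooth vector field on `M`. -/
def SmoothVectorField (X : ∀ x : M, TangentSpace (𝓡 n) x) : Prop :=
  ContMDiff (𝓡 n) (𝓡 n).tangent ∞ (fun x ↦ (⟨x, X x⟩ : TangentBundle (𝓡 n) M))

/-- `ν` is a smooth `1`-form on `M`. -/
def SmoothForm (ν : ∀ x : M, TangentSpace (𝓡 n) x →L[ℝ] ℝ) : Prop :=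
  ContMDiff (𝓡 n) ((𝓡 n).prod 𝓘(ℝ, Vec n →L[ℝ] ℝ)) ∞
    (fun x ↦ Bundle.TotalSpace.mk' (Vec n →L[ℝ] ℝ)
      (E := fun x : M ↦ TangentSpace (𝓡 n) x →L[ℝ] ℝ) x (ν x))

/-- `φ` is a smooth `(1,1)`-tensor field on `M`. -/
def SmoothEnd (φ : ∀ x : M, TangentSpace (𝓡 n) x →L[ℝ] TangentSpace (𝓡 n) x) : Prop :=
  ContMDiff (𝓡 n) ((𝓡 n).prod 𝓘(ℝ, Vec n →L[ℝ] Vec n)) ∞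
    (fun x ↦ Bundle.TotalSpace.mk' (Vec n →L[ℝ] Vec n)
      (E := fun x : M ↦ TangentSpace (𝓡 n) x →L[ℝ] TangentSpace (𝓡 n) x) x (φ x))

variable (n M) in
/-- A smooth Lorentzian metric on `M`, of signature `(-, +, …, +)`: each tangent space contains a
timelike vector `t`, and the form is positive definite on the orthogonal complement of `t`. -/
structure LorentzianMetric where
  /-- The scalar product on each tangent space. -/
  inner (x : M) : TangentSpace (𝓡 n) x →L[ℝ] TangentSpace (𝓡 n) x →L[ℝ] ℝ
  symm (x : M) (u v : TangentSpace (𝓡 n) x) : inner x u v = inner x v u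
  lorentzian (x : M) : ∃ t : TangentSpace (𝓡 n) x, inner x t t < 0 ∧
    ∀ v : TangentSpace (𝓡 n) x, inner x t v = 0 → v ≠ 0 → 0 < inner x v v
  contMDiff : ContMDiff (𝓡 n) ((𝓡 n).prod 𝓘(ℝ, Vec n →L[ℝ] Vec n →L[ℝ] ℝ)) ∞
    (fun x ↦ Bundle.TotalSpace.mk' (Vec n →L[ℝ] Vec n →L[ℝ] ℝ)
      (E := fun x : M ↦ TangentSpace (𝓡 n) x →L[ℝ] TangentSpace (𝓡 n) x →L[ℝ] ℝ) x (inner x))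

/-- `(φ, ζ, ν, g)` is a Lorentzian almost paracontact metric structure on `M`. -/
structure IsLorentzianAlmostParacontact (g : LorentzianMetric n M)
    (φ : ∀ x : M, TangentSpace (𝓡 n) x →L[ℝ] TangentSpace (𝓡 n) x)
    (ζ : ∀ x : M, TangentSpace (𝓡 n) x)
    (ν : ∀ x : M, TangentSpace (𝓡 n) x →L[ℝ] ℝ) : Prop where
  smooth_phi : SmoothEnd φ
  smooth_zeta : SmoothVectorField ζ
  smooth_nu : SmoothForm ν
  nu_zeta (x : M) : ν x (ζ x) + 1 = 0
  phi_sq (x : M) (u : TangentSpace (𝓡 n) x) : φ x (φ x u) = u + ν x u • ζ x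
  phi_zeta (x : M) : φ x (ζ x) = 0
  nu_phi (x : M) (u : TangentSpace (𝓡 n) x) : ν x (φ x u) = 0
  metric_phi (x : M) (u v : TangentSpace (𝓡 n) x) :
    g.inner x (φ x u) (φ x v) = g.inner x u v + ν x u * ν x v
  metric_zeta (x : M) (u : TangentSpace (𝓡 n) x) : g.inner x u (ζ x) = ν x u
  phi_symm (x : M) (u v : TangentSpace (𝓡 n) x) : g.inner x u (φ x v) = g.inner x v (φ x u)

/-- `(φ, ζ, ν, g)` is a Lorentzian para-Kenmotsu structure on `M`: it is Lorentzian almost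
paracontact and `(∇_E φ)F = -g(φE, F)ζ - ν(F)φE`. The tensor equation is expressed in the
coordinates of the charts at all the points `p` of `M`. -/
structure IsLPKenmotsu (g : LorentzianMetric n M)
    (φ : ∀ x : M, TangentSpace (𝓡 n) x →L[ℝ] TangentSpace (𝓡 n) x)
    (ζ : ∀ x : M, TangentSpace (𝓡 n) x)
    (ν : ∀ x : M, TangentSpace (𝓡 n) x →L[ℝ] ℝ) : Prop
    extends IsLorentzianAlmostParacontact g φ ζ ν where
  covDeriv_phi (p : M) (y : Vec n) (hy : y ∈ (extChartAt (𝓡 n) p).target) (u v : Vec n) :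
    Coord.covDerivEnd (coordBilin g.inner p) (coordEnd φ p) y u v =
      -(coordBilin g.inner p y (coordEnd φ p y u) v) • coordVec ζ p y
        - coordForm ν p y v • coordEnd φ p y u

/-- The scalar curvature of `g` is constant on `M`. -/
def HasConstantScalarCurvature (g : LorentzianMetric n M) : Prop :=
  ∃ c : ℝ, ∀ (p : M), ∀ y ∈ (extChartAt (𝓡 n) p).target,
    Coord.scalarCurvature (coordBilin g.inner p) y = c

/-- `(g, K, Λ, σ, ρ)` is a Ricci-Yamabe soliton: `K` is a smooth vector field and
`£_K g + 2σS + (2Λ - ρr)g = 0`. -/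
structure IsRicciYamabeSoliton (g : LorentzianMetric n M) (K : ∀ x : M, TangentSpace (𝓡 n) x)
    (Λ σ ρ : ℝ) : Prop where
  smooth : SmoothVectorField K
  equation (p : M) (y : Vec n) (hy : y ∈ (extChartAt (𝓡 n) p).target) (u v : Vec n) :
    Coord.lieDeriv (coordBilin g.inner p) (coordVec K p) y u v
      + 2 * σ * Coord.ricci (coordBilin g.inner p) y u v
      + (2 * Λ - ρ * Coord.scalarCurvature (coordBilin g.inner p) y)
        * coordBilin g.inner p y u v = 0

end LPK

end

noncomputable section

set_option maxSynthPendingDepth 3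

namespace LPK

/-! ### Differentiation of contracted operator-valued maps -/

section Calculus

variable {E F H H' : Type*} [NormedAddCommGroup E] [NormedSpace ℝ E]
  [NormedAddCommGroup F] [NormedSpace ℝ F] [NormedAddCommGroup H] [NormedSpace ℝ H]
  [NormedAddCommGroup H'] [NormedSpace ℝ H']

/-! Write ν = g(·, ζ). Differentiating φζ = 0 and g(ζ, ζ) = -1 turns the para-Kenmotsu equation into
∇_u ζ = -u - ν(u)ζ (`IsLeviCivitaOn.isKenmotsuOn`), after which φ plays no role. Hence R(u, v)ζ =
ν(v)u - ν(u)v, S(u, ζ) = (n - 1)ν(u), div ζ = 1 - n, and the second Bianchi identity yields ∇_ζ R =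
2(R - R₁), with R₁ of constant curvature 1 (`cov_curv`). Two contractions give ζ(r) = 2(r - n(n -
1)) (`fderiv_scalar`), so a constant r equals n(n - 1).

With m = Λ - ρr/2 the soliton equation is £_K g + 2σS + 2mg = 0. Its trace shows that div K is
constant; evaluated on ζ it reads (£_K g)(u, ζ) = -2cν(u) with c = σ(n - 1) + m. The claim is now c
= 0 (`eq_zero_of_divergence_const`). Put W = [ζ, K] and f = g(K, ζ). Then W♭ = -2cν - df is closed,
which leads to [ζ, W] = 2W + 2cζ (`bracket_bracket`). As div ζ is constant, div [ζ, X] = ζ(div X)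
(`divergence_bracket`), so div W and div [ζ, W] vanish. Taking divergences leaves 0 = 2c(1 - n), and
n ≥ 2.

The conclusion relates constants only, so everything is computed in a single chart. -/

theorem fderiv_apply_field {c : E → F →L[ℝ] H} {a : E → F} {y : E}
    (hc : DifferentiableAt ℝ c y) (ha : DifferentiableAt ℝ a y) (u : E) :
    fderiv ℝ (fun z ↦ c z (a z)) y u = fderiv ℝ c y u (a y) + c y (fderiv ℝ a y u) := by
  rw [fderiv_clm_apply hc ha]
  simp [add_comm]

theorem fderiv_apply_const {c : E → F →L[ℝ] H} {y : E}
    (hc : DifferentiableAt ℝ c y) (v : F) (u : E) :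
    fderiv ℝ (fun z ↦ c z v) y u = fderiv ℝ c y u v := by
  rw [fderiv_apply_field hc (differentiableAt_const v)]
  simp

theorem fderiv_apply_field₂ {B : E → F →L[ℝ] H →L[ℝ] H'} {a : E → F} {b : E → H} {y : E}
    (hB : DifferentiableAt ℝ B y) (ha : DifferentiableAt ℝ a y) (hb : DifferentiableAt ℝ b y)
    (u : E) :
    fderiv ℝ (fun z ↦ B z (a z) (b z)) y u =
      fderiv ℝ B y u (a y) (b y) + B y (fderiv ℝ a y u) (b y) + B y (a y) (fderiv ℝ b y u) := by
  rw [fderiv_apply_field (hB.clm_apply ha) hb, fderiv_apply_field hB ha]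
  simp

theorem fderiv_apply_const₂ {B : E → F →L[ℝ] H →L[ℝ] H'} {y : E}
    (hB : DifferentiableAt ℝ B y) (v : F) (w : H) (u : E) :
    fderiv ℝ (fun z ↦ B z v w) y u = fderiv ℝ B y u v w := by
  rw [fderiv_apply_const (hB.clm_apply (differentiableAt_const v)), fderiv_apply_const hB]

theorem fderiv_fderiv_apply {f : E → F} {y : E} (hf : ContDiffAt ℝ ∞ f y) (u v : E) :
    fderiv ℝ (fun z ↦ fderiv ℝ f z v) y u = fderiv ℝ (fderiv ℝ f) y u v :=
  fderiv_apply_const ((hf.fderiv_right (m := ∞) (by simp)).differentiableAt (by simp)) v u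

theorem fderiv_fderiv_symm {f : E → F} {y : E} (hf : ContDiffAt ℝ ∞ f y) (u v : E) :
    fderiv ℝ (fderiv ℝ f) y u v = fderiv ℝ (fderiv ℝ f) y v u :=
  (hf.isSymmSndFDerivAt (by simp; exact ENat.LEInfty.out)) u v

end Calculus

/-! ### Levi-Civita connections on an open set: symmetries of curvature and Bianchi identities -/

section Connection

variable {E : Type*} [NormedAddCommGroup E] [NormedSpace ℝ E]

/-- The curvature endomorphism `R(u, v)` of the connection with Christoffel symbols `Γ`. -/
def curv (Γ : E → E →L[ℝ] E →L[ℝ] E) (y u v : E) : E →L[ℝ] E :=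
  fderiv ℝ Γ y u v - fderiv ℝ Γ y v u + (Γ y u).comp (Γ y v) - (Γ y v).comp (Γ y u)

theorem curv_apply (Γ : E → E →L[ℝ] E →L[ℝ] E) (y u v w : E) :
    curv Γ y u v w = fderiv ℝ Γ y u v w - fderiv ℝ Γ y v u w + Γ y u (Γ y v w)
      - Γ y v (Γ y u w) := rfl

theorem curv_swap (Γ : E → E →L[ℝ] E →L[ℝ] E) (y u v w : E) : curv Γ y u v w = -curv Γ y v u w := by
  simp only [curv_apply]; abel

/-- On the open set `U`, `Γ` are the Christoffel symbols of the Levi-Civita connection of the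
smooth pseudo-Riemannian metric `G`. -/
structure IsLeviCivitaOn (U : Set E) (G : E → E →L[ℝ] E →L[ℝ] ℝ)
    (Γ : E → E →L[ℝ] E →L[ℝ] E) : Prop where
  isOpen : IsOpen U
  smooth_metric : ∀ y ∈ U, ContDiffAt ℝ ∞ G y
  smooth_connection : ∀ y ∈ U, ContDiffAt ℝ ∞ Γ y
  symm : ∀ y ∈ U, ∀ u v, G y u v = G y v u
  nondegenerate : ∀ y ∈ U, ∀ u, (∀ v, G y u v = 0) → u = 0
  torsion : ∀ y ∈ U, ∀ u v, Γ y u v = Γ y v u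
  metric : ∀ y ∈ U, ∀ u v w, fderiv ℝ G y u v w = G y (Γ y u v) w + G y v (Γ y u w)

namespace IsLeviCivitaOn

variable {U : Set E} {G : E → E →L[ℝ] E →L[ℝ] ℝ} {Γ : E → E →L[ℝ] E →L[ℝ] E}

theorem diff_metric (h : IsLeviCivitaOn U G Γ) {y : E} (hy : y ∈ U) : DifferentiableAt ℝ G y :=
  (h.smooth_metric y hy).differentiableAt (by simp)

theorem diff_connection (h : IsLeviCivitaOn U G Γ) {y : E} (hy : y ∈ U) :
    DifferentiableAt ℝ Γ y :=
  (h.smooth_connection y hy).differentiableAt (by simp)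

theorem contDiffAt_fderiv_connection (h : IsLeviCivitaOn U G Γ) {y : E} (hy : y ∈ U) :
    ContDiffAt ℝ ∞ (fderiv ℝ Γ) y :=
  (h.smooth_connection y hy).fderiv_right (by simp)

theorem diff_fderiv_connection (h : IsLeviCivitaOn U G Γ) {y : E} (hy : y ∈ U) :
    DifferentiableAt ℝ (fderiv ℝ Γ) y :=
  (h.contDiffAt_fderiv_connection hy).differentiableAt (by simp)

/-- Two functions that agree on `U` have the same derivative there. -/
theorem fderiv_eq (h : IsLeviCivitaOn U G Γ) {F : Type*} [NormedAddCommGroup F] [NormedSpace ℝ F]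
    {f f' : E → F} (hf : ∀ y ∈ U, f y = f' y) {y : E} (hy : y ∈ U) :
    fderiv ℝ f y = fderiv ℝ f' y :=
  Filter.EventuallyEq.fderiv_eq (Filter.eventuallyEq_of_mem (h.isOpen.mem_nhds hy) hf)

theorem fderiv_eq_zero_of_const (h : IsLeviCivitaOn U G Γ) {F : Type*} [NormedAddCommGroup F]
    [NormedSpace ℝ F] {f : E → F} {b : F} (hf : ∀ y ∈ U, f y = b) {y : E} (hy : y ∈ U) :
    fderiv ℝ f y = 0 := by
  rw [h.fderiv_eq (f' := fun _ ↦ b) hf hy]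
  simp

theorem eq_of_metric (h : IsLeviCivitaOn U G Γ) {y : E} (hy : y ∈ U) {u v : E}
    (huv : ∀ w, G y u w = G y v w) : u = v :=
  sub_eq_zero.1 (h.nondegenerate y hy _ fun w ↦ by simp [huv w])

theorem fderiv_torsion (h : IsLeviCivitaOn U G Γ) {y : E} (hy : y ∈ U) (u v w : E) :
    fderiv ℝ Γ y u v w = fderiv ℝ Γ y u w v := by
  have := congrArg (fun L ↦ L u) (h.fderiv_eq (f := fun z ↦ Γ z v w) (f' := fun z ↦ Γ z w v)
    (fun z hz ↦ h.torsion z hz v w) hy)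
  simpa only [fderiv_apply_const₂ (h.diff_connection hy)] using this

theorem first_bianchi (h : IsLeviCivitaOn U G Γ) {y : E} (hy : y ∈ U) (u v w : E) :
    curv Γ y u v w + curv Γ y v w u + curv Γ y w u v = 0 := by
  simp only [curv_apply]
  rw [h.fderiv_torsion hy u v w, h.fderiv_torsion hy v w u, h.fderiv_torsion hy w u v,
    h.torsion y hy v w, h.torsion y hy w u, h.torsion y hy u v]
  abel

/-- The second derivatives of `G` commute; expanding both orders by metric compatibility leaves
exactly the curvature terms. -/
theorem metric_curv_skew (h : IsLeviCivitaOn U G Γ) {y : E} (hy : y ∈ U) (u v w x : E) :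
    G y (curv Γ y u v w) x + G y w (curv Γ y u v x) = 0 := by
  have hΓ := h.diff_connection hy
  have hG := h.diff_metric hy
  have key : ∀ a b, fderiv ℝ (fderiv ℝ G) y a b w x =
      (fderiv ℝ G y a (Γ y b w) x + G y (fderiv ℝ Γ y a b w) x)
        + (fderiv ℝ G y a w (Γ y b x) + G y w (fderiv ℝ Γ y a b x)) := by
    intro a b
    have hd : ∀ c, DifferentiableAt ℝ (fun z ↦ Γ z b c) y := fun c ↦
      (hΓ.clm_apply (differentiableAt_const b)).clm_apply (differentiableAt_const c)
    have h2 : DifferentiableAt ℝ (fderiv ℝ G) y :=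
      ((h.smooth_metric y hy).fderiv_right (m := ∞) (by simp)).differentiableAt (by simp)
    have e1 : fderiv ℝ (fun z ↦ fderiv ℝ G z b w x) y a = fderiv ℝ (fderiv ℝ G) y a b w x := by
      rw [fderiv_apply_const₂ (h2.clm_apply (differentiableAt_const b)), fderiv_apply_const h2]
    rw [← e1, h.fderiv_eq (fun z hz ↦ h.metric z hz b w x) hy,
      fderiv_fun_add ((hG.clm_apply (hd w)).clm_apply (differentiableAt_const x))
        ((hG.clm_apply (differentiableAt_const w)).clm_apply (hd x)),
      add_apply, fderiv_apply_field₂ hG (hd w) (differentiableAt_const x),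
      fderiv_apply_field₂ hG (differentiableAt_const w) (hd x), fderiv_apply_const₂ hΓ,
      fderiv_apply_const₂ hΓ]
    simp
  have hs := congrArg (fun L ↦ L w x) (fderiv_fderiv_symm (h.smooth_metric y hy) u v)
  simp only [key, h.metric y hy] at hs
  simp only [curv_apply, map_add, map_sub, add_apply, sub_apply]
  linarith

theorem metric_curv_pair (h : IsLeviCivitaOn U G Γ) {y : E} (hy : y ∈ U) (u v w x : E) :
    G y (curv Γ y u v w) x = G y (curv Γ y w x u) v := by
  have b : ∀ a b c d, G y (curv Γ y a b c) d + G y (curv Γ y b c a) d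
      + G y (curv Γ y c a b) d = 0 := by
    intro a b c d
    have := congrArg (fun e ↦ G y e d) (h.first_bianchi hy a b c)
    simpa using this
  have s : ∀ a b c d, G y (curv Γ y a b c) d = -G y (curv Γ y a b d) c := by
    intro a b c d
    have := h.metric_curv_skew hy a b c d
    rw [h.symm y hy c] at this
    linarith
  have t : ∀ a b c d, G y (curv Γ y a b c) d = -G y (curv Γ y b a c) d := by
    intro a b c d
    rw [curv_swap]; simp
  -- The octahedron argument: four first Bianchi identities are added, and all other terms cancel by
  -- the skew symmetries.
  linarith [b u v w x, b v w x u, b w x u v, b x u v w, s u v w x, s v w x u, s w x u v,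
    s x u v w, s u w v x, s v x w u, t u w v x, t v x w u, s w u v x, s x v w u, t u v w x,
    t w x u v, t v w x u, t x u v w, t v x u w, s v x u w, s u v x w, s w x v u, t w x v u]

theorem fderiv_curv (h : IsLeviCivitaOn U G Γ) {y : E} (hy : y ∈ U) (u v w x : E) :
    fderiv ℝ (fun z ↦ curv Γ z v w) y u x =
      fderiv ℝ (fderiv ℝ Γ) y u v w x - fderiv ℝ (fderiv ℝ Γ) y u w v x
      + (fderiv ℝ Γ y u v (Γ y w x) + Γ y v (fderiv ℝ Γ y u w x))
      - (fderiv ℝ Γ y u w (Γ y v x) + Γ y w (fderiv ℝ Γ y u v x)) := by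
  have hΓ := h.diff_connection hy
  have h2 := h.diff_fderiv_connection hy
  have c1 : ∀ a, DifferentiableAt ℝ (fun z ↦ Γ z a) y := fun a ↦
    hΓ.clm_apply (differentiableAt_const a)
  have c2 : ∀ a b, DifferentiableAt ℝ (fun z ↦ fderiv ℝ Γ z a b) y := fun a b ↦
    (h2.clm_apply (differentiableAt_const a)).clm_apply (differentiableAt_const b)
  unfold curv
  rw [fderiv_fun_sub (((c2 v w).fun_sub (c2 w v)).fun_add ((c1 v).clm_comp (c1 w)))
      ((c1 w).clm_comp (c1 v)),
    fderiv_fun_add ((c2 v w).fun_sub (c2 w v)) ((c1 v).clm_comp (c1 w)),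
    fderiv_fun_sub (c2 v w) (c2 w v), fderiv_clm_comp (c1 v) (c1 w),
    fderiv_clm_comp (c1 w) (c1 v)]
  simp only [add_apply, sub_apply, fderiv_apply_const₂ h2, ContinuousLinearMap.comp_apply,
    ContinuousLinearMap.compL_apply, ContinuousLinearMap.flip_apply, fderiv_apply_const hΓ]
  abel

/-- The corrections `Γ` would make in the two slots of the curvature 2-form cancel in the cyclic sum
for a torsion-free connection, so only the endomorphism part is differentiated covariantly. What
remains is the symmetry of the second derivative of `Γ`. -/
theorem second_bianchi (h : IsLeviCivitaOn U G Γ) {y : E} (hy : y ∈ U) (u v w x : E) :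
    (fderiv ℝ (fun z ↦ curv Γ z v w) y u x + Γ y u (curv Γ y v w x) - curv Γ y v w (Γ y u x))
    + (fderiv ℝ (fun z ↦ curv Γ z w u) y v x + Γ y v (curv Γ y w u x) - curv Γ y w u (Γ y v x))
    + (fderiv ℝ (fun z ↦ curv Γ z u v) y w x + Γ y w (curv Γ y u v x)
      - curv Γ y u v (Γ y w x)) = 0 := by
  have s := fderiv_fderiv_symm (h.smooth_connection y hy)
  simp only [h.fderiv_curv hy, curv_apply, map_add, map_sub]
  rw [s v u, s w v, s u w]
  abel

end IsLeviCivitaOn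

end Connection

/-! ### Curvature in the presence of a Kenmotsu field -/

section Curvature

variable {E : Type*} [NormedAddCommGroup E] [NormedSpace ℝ E]

/-- The linear map `u ↦ R(u, v)`. -/
def curvLeft (Γ : E → E →L[ℝ] E →L[ℝ] E) (v y : E) : E →L[ℝ] E →L[ℝ] E :=
  (fderiv ℝ Γ y).flip v - fderiv ℝ Γ y v
    + ((ContinuousLinearMap.compL ℝ E E E).flip (Γ y v)).comp (Γ y)
    - (ContinuousLinearMap.compL ℝ E E E (Γ y v)).comp (Γ y)

theorem curvLeft_apply (Γ : E → E →L[ℝ] E →L[ℝ] E) (v y u : E) :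
    curvLeft Γ v y u = curv Γ y u v := rfl

/-- The vector field `Z` is of Kenmotsu type for the metric `G` with Christoffel symbols `Γ`:
`G(Z, Z) = -1` and `∇_u Z = -u - G(u, Z) Z`. -/
structure IsKenmotsuOn (U : Set E) (G : E → E →L[ℝ] E →L[ℝ] ℝ)
    (Γ : E → E →L[ℝ] E →L[ℝ] E) (Z : E → E) : Prop extends IsLeviCivitaOn U G Γ where
  smooth_field : ∀ y ∈ U, ContDiffAt ℝ ∞ Z y
  unit : ∀ y ∈ U, G y (Z y) (Z y) = -1
  cov : ∀ y ∈ U, ∀ u, fderiv ℝ Z y u + Γ y u (Z y) = -u - G y u (Z y) • Z y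

/-- From ΦZ = 0, Φ(∇_u Z) = -(∇_u Φ)Z = -Φu. Applying Φ again and using Φ² = id + ν ⊗ Z recovers ∇_u
Z, because G(Z, Z) = -1 forces G(∇_u Z, Z) = 0. -/
theorem IsLeviCivitaOn.isKenmotsuOn {U : Set E} {G : E → E →L[ℝ] E →L[ℝ] ℝ}
    {Γ : E → E →L[ℝ] E →L[ℝ] E} (h : IsLeviCivitaOn U G Γ) {Φ : E → E →L[ℝ] E} {Z : E → E}
    (hZ : ∀ y ∈ U, ContDiffAt ℝ ∞ Z y) (hΦ : ∀ y ∈ U, DifferentiableAt ℝ Φ y)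
    (unit : ∀ y ∈ U, G y (Z y) (Z y) = -1) (hΦZ : ∀ y ∈ U, Φ y (Z y) = 0)
    (hνΦ : ∀ y ∈ U, ∀ u, G y (Φ y u) (Z y) = 0)
    (sq : ∀ y ∈ U, ∀ u, Φ y (Φ y u) = u + G y u (Z y) • Z y)
    (cov : ∀ y ∈ U, ∀ u v, fderiv ℝ Φ y u v + Γ y u (Φ y v) - Φ y (Γ y u v) =
      -(G y (Φ y u) v) • Z y - G y v (Z y) • Φ y u) : IsKenmotsuOn U G Γ Z := by
  refine { h with smooth_field := hZ, unit := unit, cov := fun y hy u ↦ ?_ }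
  have dZ : DifferentiableAt ℝ Z y := (hZ y hy).differentiableAt (by simp)
  have e1 := congrArg (fun L ↦ L u) (h.fderiv_eq_zero_of_const hΦZ hy)
  simp only [fderiv_apply_field (hΦ y hy) dZ, zero_apply] at e1
  have e2 := cov y hy u (Z y)
  rw [hΦZ y hy, hνΦ y hy, unit y hy, map_zero] at e2
  have e3 : Φ y (fderiv ℝ Z y u + Γ y u (Z y)) = -Φ y u := by
    rw [map_add, eq_neg_of_add_eq_zero_right e1]
    have : fderiv ℝ Φ y u (Z y) - Φ y (Γ y u (Z y)) = Φ y u := by simpa using e2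
    rw [← this]; abel
  have e4 := congrArg (fun L ↦ L u) (h.fderiv_eq_zero_of_const unit hy)
  simp only [fderiv_apply_field₂ (h.diff_metric hy) dZ dZ, zero_apply,
    h.metric y hy] at e4
  have e5 : G y (fderiv ℝ Z y u + Γ y u (Z y)) (Z y) = 0 := by
    rw [h.symm y hy (Z y) (fderiv ℝ Z y u), h.symm y hy (Z y) (Γ y u (Z y))] at e4
    rw [map_add, add_apply]
    linarith
  have e6 := sq y hy (fderiv ℝ Z y u + Γ y u (Z y))
  rw [e5, e3, map_neg, sq y hy u, zero_smul, add_zero] at e6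
  rw [← e6]; abel

theorem IsLeviCivitaOn.differentiableAt_curvLeft {U : Set E} {G : E → E →L[ℝ] E →L[ℝ] ℝ}
    {Γ : E → E →L[ℝ] E →L[ℝ] E} (h : IsLeviCivitaOn U G Γ) {y : E} (hy : y ∈ U) (v : E) :
    DifferentiableAt ℝ (curvLeft Γ v) y := by
  have hΓ := h.diff_connection hy
  have h2 := h.diff_fderiv_connection hy
  have c1 : DifferentiableAt ℝ (fun z ↦ Γ z v) y := hΓ.clm_apply (differentiableAt_const v)
  have f1 : DifferentiableAt ℝ (fun z ↦ (fderiv ℝ Γ z).flip) y :=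
    (ContinuousLinearMap.flipₗᵢ ℝ E E (E →L[ℝ] E)).differentiableAt.comp y h2
  unfold curvLeft
  exact (((f1.clm_apply (differentiableAt_const v)).fun_sub
    (h2.clm_apply (differentiableAt_const v))).fun_add
    (((differentiableAt_const _).clm_apply c1).clm_comp hΓ)).fun_sub
    (((differentiableAt_const _).clm_apply c1).clm_comp hΓ)

theorem IsLeviCivitaOn.fderiv_curvLeft {U : Set E} {G : E → E →L[ℝ] E →L[ℝ] ℝ}
    {Γ : E → E →L[ℝ] E →L[ℝ] E} (h : IsLeviCivitaOn U G Γ) {y : E} (hy : y ∈ U) (u v w : E) :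
    fderiv ℝ (curvLeft Γ v) y u w = fderiv ℝ (fun z ↦ curv Γ z w v) y u :=
  (fderiv_apply_const (h.differentiableAt_curvLeft hy v) w u).symm

namespace IsKenmotsuOn

variable {U : Set E} {G : E → E →L[ℝ] E →L[ℝ] ℝ} {Γ : E → E →L[ℝ] E →L[ℝ] E} {Z : E → E}

theorem diff_field (h : IsKenmotsuOn U G Γ Z) {y : E} (hy : y ∈ U) : DifferentiableAt ℝ Z y :=
  (h.smooth_field y hy).differentiableAt (by simp)

theorem fderiv_field (h : IsKenmotsuOn U G Γ Z) {y : E} (hy : y ∈ U) (u : E) :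
    fderiv ℝ Z y u = -u - G y u (Z y) • Z y - Γ y u (Z y) := by
  rw [← h.cov y hy u]; abel

theorem fderiv_form (h : IsKenmotsuOn U G Γ Z) {y : E} (hy : y ∈ U) (u v : E) :
    fderiv ℝ (fun z ↦ G z v (Z z)) y u =
      G y (Γ y u v) (Z y) - G y u v - G y u (Z y) * G y v (Z y) := by
  rw [fderiv_apply_field₂ (h.diff_metric hy) (differentiableAt_const v) (h.diff_field hy),
    h.metric y hy, h.fderiv_field hy, h.symm y hy u v]
  simp
  ring

theorem differentiableAt_form (h : IsKenmotsuOn U G Γ Z) {y : E} (hy : y ∈ U) (v : E) :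
    DifferentiableAt ℝ (fun z ↦ G z v (Z z)) y :=
  ((h.diff_metric hy).clm_apply (differentiableAt_const v)).clm_apply (h.diff_field hy)

/-- The Ricci identity for `Z`: the formula for ∇Z is differentiated once more, and the two orders
of differentiation are compared. -/
theorem curv_field (h : IsKenmotsuOn U G Γ Z) {y : E} (hy : y ∈ U) (u v : E) :
    curv Γ y u v (Z y) = G y v (Z y) • u - G y u (Z y) • v := by
  have hΓ := h.diff_connection hy
  have dZ := h.diff_field hy
  have key : ∀ a b, fderiv ℝ (fderiv ℝ Z) y a b =
      -(G y b (Z y) • fderiv ℝ Z y a + (G y (Γ y a b) (Z y) - G y a b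
        - G y a (Z y) * G y b (Z y)) • Z y)
        - (fderiv ℝ Γ y a b (Z y) + Γ y b (fderiv ℝ Z y a)) := by
    intro a b
    rw [← fderiv_fderiv_apply (h.smooth_field y hy),
      h.fderiv_eq (fun z hz ↦ h.fderiv_field hz b) hy,
      fderiv_fun_sub ((differentiableAt_const _).fun_sub
        ((h.differentiableAt_form hy b).fun_smul dZ))
        ((hΓ.clm_apply (differentiableAt_const b)).clm_apply dZ),
      fderiv_fun_sub (differentiableAt_const _) ((h.differentiableAt_form hy b).fun_smul dZ),
      fderiv_fun_smul (h.differentiableAt_form hy b) dZ, sub_apply,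
      fderiv_apply_field₂ hΓ (differentiableAt_const b) dZ]
    simp [h.fderiv_form hy]
  have hs := fderiv_fderiv_symm (h.smooth_field y hy) u v
  rw [key, key, h.torsion y hy v u, h.symm y hy v u, h.fderiv_field hy, h.fderiv_field hy] at hs
  simp only [map_sub, map_neg, map_smul] at hs
  rw [h.torsion y hy v u] at hs
  rw [curv_apply]
  linear_combination (norm := module) (-1 : ℝ) • hs

/-- Pair symmetry moves `Z` from the first slot to the third, where `curv_field` applies. -/
theorem curv_field_left (h : IsKenmotsuOn U G Γ Z) {y : E} (hy : y ∈ U) (u v : E) :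
    curv Γ y (Z y) u v = G y u v • Z y - G y v (Z y) • u := by
  refine h.eq_of_metric hy fun w ↦ ?_
  rw [h.metric_curv_pair hy, h.curv_field hy]
  simp [h.symm y hy v u, h.symm y hy w u, h.symm y hy (Z y) w]
  ring

/-- The field is frozen at `Z y` on the left. The derivative of `curv_field_left`, where `Z` varies,
is therefore corrected by a term in ∂_u Z. -/
theorem fderiv_curv_field (h : IsKenmotsuOn U G Γ Z) {y : E} (hy : y ∈ U) (u v w : E) :
    fderiv ℝ (fun z ↦ curv Γ z (Z y) v) y u w =
      (G y (Γ y u v) w + G y v (Γ y u w)) • Z y + G y v w • fderiv ℝ Z y u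
        - (G y (Γ y u w) (Z y) - G y u w - G y u (Z y) * G y w (Z y)) • v
        - curv Γ y (fderiv ℝ Z y u) v w := by
  have dG := h.diff_metric hy
  have dZ := h.diff_field hy
  have dc := h.differentiableAt_curvLeft hy v
  have dGvw : DifferentiableAt ℝ (fun z ↦ G z v w) y :=
    (dG.clm_apply (differentiableAt_const v)).clm_apply (differentiableAt_const w)
  have e1 := congrArg (fun L ↦ L u) (h.fderiv_eq (fun z hz ↦ h.curv_field_left hz v w) hy)
  simp only [← curvLeft_apply] at e1
  rw [fderiv_apply_field₂ dc dZ (differentiableAt_const w), h.fderiv_curvLeft hy,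
    fderiv_fun_sub (dGvw.fun_smul dZ)
      ((h.differentiableAt_form hy w).fun_smul (differentiableAt_const v)),
    fderiv_fun_smul dGvw dZ,
    fderiv_fun_smul (h.differentiableAt_form hy w) (differentiableAt_const v)] at e1
  simp only [sub_apply, add_apply, smul_apply, ContinuousLinearMap.smulRight_apply,
    fderiv_apply_const₂ dG, h.fderiv_form hy, h.metric y hy, fderiv_fun_const, Pi.zero_apply,
    zero_apply, map_zero, smul_zero, zero_add, add_zero, curvLeft_apply] at e1
  rw [eq_sub_of_add_eq e1]
  abel

/-- `∇_Z R = 2 (R - R₁)`, where `R₁` is the curvature tensor of constant curvature `1`. -/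
theorem cov_curv (h : IsKenmotsuOn U G Γ Z) {y : E} (hy : y ∈ U) (u v w : E) :
    fderiv ℝ (fun z ↦ curv Γ z u v) y (Z y) w + Γ y (Z y) (curv Γ y u v w)
      - curv Γ y u v (Γ y (Z y) w) - curv Γ y (Γ y (Z y) u) v w - curv Γ y u (Γ y (Z y) v) w =
    (2 : ℝ) • (curv Γ y u v w - G y v w • u + G y u w • v) := by
  -- Two of the three cyclic terms differentiate R(Z, ·), which is known. The summand -u of ∇_u Z
  -- makes each contribute a copy of R(u, v), whence the factor 2.
  have hb := h.second_bianchi hy (Z y) u v w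
  have e1 : fderiv ℝ (fun z ↦ curv Γ z v (Z y)) y u w =
      -fderiv ℝ (fun z ↦ curv Γ z (Z y) v) y u w := by
    have : (fun z ↦ curv Γ z v (Z y)) = fun z ↦ -curv Γ z (Z y) v := by
      funext z; ext x; exact curv_swap Γ z v (Z y) x
    rw [this, fderiv_fun_neg]; rfl
  have add_left : ∀ a b c x, curv Γ y (a + b) c x = curv Γ y a c x + curv Γ y b c x := by
    intro a b c x; simp only [← curvLeft_apply, map_add, add_apply]
  have smul_left : ∀ (r : ℝ) a c x, curv Γ y (r • a) c x = r • curv Γ y a c x := by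
    intro r a c x; simp only [← curvLeft_apply, map_smul, smul_apply]
  have field : ∀ a, fderiv ℝ Z y a =
      (-1 : ℝ) • a + (-G y a (Z y)) • Z y + (-1 : ℝ) • Γ y (Z y) a := by
    intro a
    rw [h.fderiv_field hy, h.torsion y hy a]
    simp only [neg_smul, one_smul]; abel
  rw [e1, h.fderiv_curv_field hy, h.fderiv_curv_field hy, curv_swap Γ y v (Z y),
    curv_swap Γ y v (Z y)] at hb
  simp only [field, add_left, smul_left, h.curv_field_left hy] at hb
  rw [curv_swap Γ y (Γ y (Z y) v) u w, curv_swap Γ y v u w] at hb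
  simp only [map_neg, map_sub, map_smul, h.torsion y hy u (Z y), h.torsion y hy v (Z y),
    h.torsion y hy v u] at hb
  linear_combination (norm := module) (1 : ℝ) • hb

end IsKenmotsuOn

end Curvature

/-! ### Traces: Ricci and scalar curvature, divergence -/

section Trace

variable {E : Type*} [NormedAddCommGroup E] [NormedSpace ℝ E] [FiniteDimensional ℝ E]

variable (E) in
/-- The trace of an endomorphism of `E`, as a continuous linear form. -/
def tr : (E →L[ℝ] E) →L[ℝ] ℝ :=
  LinearMap.toContinuousLinearMap (LinearMap.trace ℝ E ∘ₗ ContinuousLinearMap.coeLM ℝ)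

theorem tr_apply (A : E →L[ℝ] E) : tr E A = LinearMap.trace ℝ E (A : E →ₗ[ℝ] E) := rfl

theorem tr_comp_comm (A B : E →L[ℝ] E) : tr E (A.comp B) = tr E (B.comp A) :=
  LinearMap.trace_mul_comm ℝ (A : E →ₗ[ℝ] E) (B : E →ₗ[ℝ] E)

theorem tr_id : tr E (ContinuousLinearMap.id ℝ E) = Module.finrank ℝ E :=
  LinearMap.trace_id ℝ E

theorem tr_smulRight (f : E →L[ℝ] ℝ) (v : E) : tr E (f.smulRight v) = f v :=
  LinearMap.trace_smulRight (f : E →ₗ[ℝ] ℝ) v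

/-- Under the isomorphism of `E` with its dual given by `g`, the adjoint `B` becomes the transpose
of `A`. -/
theorem tr_eq_of_adjoint (g : E →L[ℝ] E →L[ℝ] ℝ) (hs : ∀ u v, g u v = g v u)
    (hn : ∀ u, (∀ v, g u v = 0) → u = 0) (A B : E →L[ℝ] E) (hAB : ∀ u v, g (A u) v = g u (B v)) :
    tr E A = tr E B := by
  let e₀ : E →ₗ[ℝ] Module.Dual ℝ E := (ContinuousLinearMap.coeLM ℝ).comp (g : E →ₗ[ℝ] E →L[ℝ] ℝ)
  have inj : Function.Injective e₀ := (injective_iff_map_eq_zero _).2 fun u hu ↦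
    hn u fun v ↦ LinearMap.congr_fun hu v
  let e : E ≃ₗ[ℝ] Module.Dual ℝ E := LinearEquiv.ofInjectiveOfFinrankEq e₀ inj
    Subspace.dual_finrank_eq.symm
  have he : ∀ u v, e u v = g u v := fun u v ↦ rfl
  have : e.conj (B : E →ₗ[ℝ] E) = Module.Dual.transpose (A : E →ₗ[ℝ] E) := by
    ext f v
    obtain ⟨u, rfl⟩ := e.surjective f
    rw [LinearEquiv.conj_apply_apply, e.symm_apply_apply, Module.Dual.transpose_apply]
    simp only [LinearMap.comp_apply, he, ContinuousLinearMap.coe_coe]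
    rw [hs, ← hAB, hs]
  rw [tr_apply, tr_apply, ← LinearMap.trace_conj' (B : E →ₗ[ℝ] E) e, this,
    LinearMap.trace_transpose']

/-- The Ricci tensor `S(v, w) = tr (u ↦ R(u, v)w)`. -/
def ric (Γ : E → E →L[ℝ] E →L[ℝ] E) (y v w : E) : ℝ := tr E ((curvLeft Γ v y).flip w)

namespace IsLeviCivitaOn

variable {U : Set E} {G : E → E →L[ℝ] E →L[ℝ] ℝ} {Γ : E → E →L[ℝ] E →L[ℝ] E}

theorem fderiv_ric (h : IsLeviCivitaOn U G Γ) {y : E} (hy : y ∈ U) (u v w : E) :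
    DifferentiableAt ℝ (fun z ↦ ric Γ z v w) y ∧
    fderiv ℝ (fun z ↦ ric Γ z v w) y u = tr E ((fderiv ℝ (curvLeft Γ v) y u).flip w) := by
  let L : (E →L[ℝ] E →L[ℝ] E) →L[ℝ] ℝ := (tr E).comp
    ((ContinuousLinearMap.apply ℝ (E →L[ℝ] E) w).comp
      ((ContinuousLinearMap.flipₗᵢ ℝ E E E : _ →L[ℝ] _)))
  have := (L.hasFDerivAt (x := curvLeft Γ v y)).comp y
    (h.differentiableAt_curvLeft hy v).hasFDerivAt
  have e : (fun z ↦ ric Γ z v w) = L ∘ curvLeft Γ v := rfl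
  rw [e]
  exact ⟨this.differentiableAt, by rw [this.fderiv]; rfl⟩

end IsLeviCivitaOn

/-- The divergence of the vector field `X`. -/
def divergence (Γ : E → E →L[ℝ] E →L[ℝ] E) (X : E → E) (y : E) : ℝ :=
  tr E (fderiv ℝ X y) + tr E (Γ y (X y))

/-- The Lie bracket `[Z, X]` of vector fields. -/
def bracket {E : Type*} [NormedAddCommGroup E] [NormedSpace ℝ E] (Z X : E → E) (y : E) : E :=
  fderiv ℝ X y (Z y) - fderiv ℝ Z y (X y)

theorem contDiffAt_bracket {E : Type*} [NormedAddCommGroup E] [NormedSpace ℝ E] {Z X : E → E}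
    {y : E} (hZ : ContDiffAt ℝ ∞ Z y) (hX : ContDiffAt ℝ ∞ X y) :
    ContDiffAt ℝ ∞ (bracket Z X) y :=
  ((hX.fderiv_right (m := ∞) (by simp)).clm_apply hZ).sub
    ((hZ.fderiv_right (m := ∞) (by simp)).clm_apply hX)

namespace IsKenmotsuOn

variable {U : Set E} {G : E → E →L[ℝ] E →L[ℝ] ℝ} {Γ : E → E →L[ℝ] E →L[ℝ] E} {Z : E → E}

theorem ric_field (h : IsKenmotsuOn U G Γ Z) {y : E} (hy : y ∈ U) (v : E) :
    ric Γ y v (Z y) = (Module.finrank ℝ E - 1) * G y v (Z y) := by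
  have : (curvLeft Γ v y).flip (Z y) = G y v (Z y) • ContinuousLinearMap.id ℝ E
      - ((G y).flip (Z y)).smulRight v := by
    ext u
    simp [curvLeft_apply, h.curv_field hy]
  rw [ric, this, map_sub, map_smul, tr_id, tr_smulRight]
  simp
  ring

/-- This is the trace of `cov_curv` over its first slot; the `Γ` terms acting on that slot and on
the value form a commutator, which is traceless. -/
theorem cov_ric (h : IsKenmotsuOn U G Γ Z) {y : E} (hy : y ∈ U) (v w : E) :
    fderiv ℝ (fun z ↦ ric Γ z v w) y (Z y) - ric Γ y v (Γ y (Z y) w) - ric Γ y (Γ y (Z y) v) w =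
      2 * (ric Γ y v w - (Module.finrank ℝ E - 1) * G y v w) := by
  have key : (fderiv ℝ (curvLeft Γ v) y (Z y)).flip w
      + (Γ y (Z y)).comp ((curvLeft Γ v y).flip w)
      - (curvLeft Γ v y).flip (Γ y (Z y) w) - ((curvLeft Γ v y).flip w).comp (Γ y (Z y))
      - (curvLeft Γ (Γ y (Z y) v) y).flip w =
      (2 : ℝ) • ((curvLeft Γ v y).flip w - G y v w • ContinuousLinearMap.id ℝ E
        + ((G y).flip w).smulRight v) := by
    ext u
    simp [curvLeft_apply, h.fderiv_curvLeft hy, h.cov_curv hy u v w]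
  have := congrArg (tr E) key
  simp only [map_sub, map_add, map_smul, tr_id, tr_smulRight] at this
  rw [tr_comp_comm (Γ y (Z y)), ← (h.fderiv_ric hy (Z y) v w).2] at this
  simp only [ContinuousLinearMap.flip_apply, smul_eq_mul] at this
  simp only [ric] at this ⊢
  linarith

/-- The scalar curvature `r = tr A`, where `A` is the Ricci endomorphism, satisfies
`Z r = 2 (r - n (n - 1))`. -/
theorem fderiv_scalar (h : IsKenmotsuOn U G Γ Z) {A : E → E →L[ℝ] E}
    (hA : ∀ y ∈ U, DifferentiableAt ℝ A y) (hAric : ∀ y ∈ U, ∀ v w, G y (A y v) w = ric Γ y v w)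
    {y : E} (hy : y ∈ U) :
    fderiv ℝ (fun z ↦ tr E (A z)) y (Z y) =
      2 * (tr E (A y) - Module.finrank ℝ E * (Module.finrank ℝ E - 1)) := by
  -- `cov_ric` with an index raised, that is ∇_Z A = 2(A - (n - 1) id); the metric is parallel.
  have key : fderiv ℝ A y (Z y) + (Γ y (Z y)).comp (A y) - (A y).comp (Γ y (Z y)) =
      (2 : ℝ) • (A y - ((Module.finrank ℝ E : ℝ) - 1) • ContinuousLinearMap.id ℝ E) := by
    ext v
    refine h.eq_of_metric hy fun w ↦ ?_
    have e1 := congrArg (fun L ↦ L (Z y)) (h.fderiv_eq (fun z hz ↦ hAric z hz v w) hy)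
    simp only [fderiv_apply_field₂ (h.diff_metric hy)
      ((hA y hy).clm_apply (differentiableAt_const v)) (differentiableAt_const w),
      fderiv_apply_const (hA y hy), h.metric y hy] at e1
    have e2 := h.cov_ric hy v w
    simp only [← hAric y hy] at e2
    simp at e1 ⊢
    linarith
  have := congrArg (tr E) key
  simp only [map_sub, map_add, map_smul, tr_id, tr_comp_comm (Γ y (Z y))] at this
  have e : fderiv ℝ (fun z ↦ tr E (A z)) y (Z y) = tr E (fderiv ℝ A y (Z y)) := by
    have := ((tr E).hasFDerivAt (x := A y)).comp y (hA y hy).hasFDerivAt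
    have e : (fun z ↦ tr E (A z)) = tr E ∘ A := rfl
    rw [e, this.fderiv]; rfl
  rw [e]
  simp only [smul_eq_mul] at this
  linarith

theorem divergence_field (h : IsKenmotsuOn U G Γ Z) {y : E} (hy : y ∈ U) :
    divergence Γ Z y = 1 - Module.finrank ℝ E := by
  have : fderiv ℝ Z y + Γ y (Z y) =
      -ContinuousLinearMap.id ℝ E - ((G y).flip (Z y)).smulRight (Z y) := by
    ext u
    simp [← h.cov y hy u, h.torsion y hy u]
  rw [divergence, ← map_add, this, map_sub, map_neg, tr_id, tr_smulRight]
  simp [h.unit y hy]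
  ring

/-- The endomorphism R(Z, x) has trace zero, as its explicit form in `curv_field_left` shows. -/
theorem tr_fderiv_connection (h : IsKenmotsuOn U G Γ Z) {y : E} (hy : y ∈ U) (x : E) :
    tr E (fderiv ℝ Γ y (Z y) x) = tr E (fderiv ℝ Γ y x (Z y)) := by
  have key : fderiv ℝ Γ y (Z y) x - fderiv ℝ Γ y x (Z y) + (Γ y (Z y)).comp (Γ y x)
      - (Γ y x).comp (Γ y (Z y)) =
      (G y x).smulRight (Z y) - ((G y).flip (Z y)).smulRight x := by
    ext v
    have := h.curv_field_left hy x v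
    simpa [curv_apply] using this
  have := congrArg (tr E) key
  simp only [map_sub, map_add, tr_smulRight, tr_comp_comm (Γ y (Z y))] at this
  simp at this
  linarith

theorem fderiv_divergence (h : IsLeviCivitaOn U G Γ) {X : E → E} {y : E} (hy : y ∈ U)
    (hX : ContDiffAt ℝ ∞ X y) (u : E) :
    fderiv ℝ (divergence Γ X) y u = tr E (fderiv ℝ (fderiv ℝ X) y u)
      + tr E (fderiv ℝ Γ y u (X y)) + tr E (Γ y (fderiv ℝ X y u)) := by
  have h2 : DifferentiableAt ℝ (fderiv ℝ X) y :=
    (hX.fderiv_right (m := ∞) (by simp)).differentiableAt (by simp)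
  have hX1 : DifferentiableAt ℝ X y := hX.differentiableAt (by simp)
  have hΓ := h.diff_connection hy
  have e : divergence Γ X = fun z ↦ tr E (fderiv ℝ X z + Γ z (X z)) := by
    funext z; simp [divergence]
  rw [e, fderiv_apply_field (differentiableAt_const _) (h2.fun_add (hΓ.clm_apply hX1)),
    fderiv_fun_add h2 (hΓ.clm_apply hX1), add_apply, fderiv_apply_field hΓ hX1]
  simp [add_assoc]

/-- `div [Z, X] = Z (div X)`, as `div Z` is constant. -/
theorem divergence_bracket (h : IsKenmotsuOn U G Γ Z) {X : E → E} {y : E} (hy : y ∈ U)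
    (hX : ContDiffAt ℝ ∞ X y) :
    divergence Γ (bracket Z X) y = fderiv ℝ (divergence Γ X) y (Z y) := by
  have hZ := h.smooth_field y hy
  have d2 : ∀ {Y : E → E}, ContDiffAt ℝ ∞ Y y → DifferentiableAt ℝ (fderiv ℝ Y) y := fun hY ↦
    (hY.fderiv_right (m := ∞) (by simp)).differentiableAt (by simp)
  have dZ : DifferentiableAt ℝ Z y := hZ.differentiableAt (by simp)
  have dX : DifferentiableAt ℝ X y := hX.differentiableAt (by simp)
  -- X(div Z) = 0 eliminates the trace of the second derivative of `Z`.
  have e0 := congrArg (fun L ↦ L (X y)) (h.fderiv_eq_zero_of_const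
    (fun z hz ↦ h.divergence_field hz) hy)
  simp only [fderiv_divergence h.toIsLeviCivitaOn hy hZ, zero_apply] at e0
  have e1 : fderiv ℝ (bracket Z X) y = fderiv ℝ (fderiv ℝ X) y (Z y)
      + (fderiv ℝ X y).comp (fderiv ℝ Z y) - fderiv ℝ (fderiv ℝ Z) y (X y)
      - (fderiv ℝ Z y).comp (fderiv ℝ X y) := by
    ext u
    unfold bracket
    rw [fderiv_fun_sub ((d2 hX).clm_apply dZ) ((d2 hZ).clm_apply dX), sub_apply,
      fderiv_apply_field (d2 hX) dZ, fderiv_apply_field (d2 hZ) dX, fderiv_fderiv_symm hX u,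
      fderiv_fderiv_symm hZ u]
    simp
    abel
  rw [fderiv_divergence h.toIsLeviCivitaOn hy hX, divergence, e1]
  simp only [bracket, map_add, map_sub]
  rw [tr_comp_comm (fderiv ℝ X y), h.tr_fderiv_connection hy]
  linarith

end IsKenmotsuOn

end Trace

/-! ### The soliton equation and iterated brackets with the Kenmotsu field -/

section Soliton

variable {E : Type*} [NormedAddCommGroup E] [NormedSpace ℝ E]
  {U : Set E} {G : E → E →L[ℝ] E →L[ℝ] ℝ} {Γ : E → E →L[ℝ] E →L[ℝ] E} {Z : E → E}

namespace IsKenmotsuOn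

theorem fderiv_metric_field (h : IsKenmotsuOn U G Γ Z) {X : E → E} {y : E} (hy : y ∈ U)
    (hX : DifferentiableAt ℝ X y) (u : E) :
    fderiv ℝ (fun z ↦ G z (X z) (Z z)) y u =
      G y (fderiv ℝ X y u + Γ y u (X y)) (Z y) - G y (X y) u
        - G y u (Z y) * G y (X y) (Z y) := by
  rw [fderiv_apply_field₂ (h.diff_metric hy) hX (h.diff_field hy), h.metric y hy,
    h.fderiv_field hy]
  simp
  ring

/-- Without torsion, [Z, X] = ∇_Z X - ∇_X Z. -/
theorem bracket_eq (h : IsKenmotsuOn U G Γ Z) {X : E → E} {y : E} (hy : y ∈ U) :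
    bracket Z X y = fderiv ℝ X y (Z y) + Γ y (Z y) (X y) + X y + G y (X y) (Z y) • Z y := by
  rw [bracket, h.fderiv_field hy, h.torsion y hy (X y)]
  abel

/-- If `(£_X G)(u, Z) = -2 c G(u, Z)` and `f = G(X, Z)`, then `[Z, X]♭ = -2 c Z♭ - df`. -/
theorem metric_bracket (h : IsKenmotsuOn U G Γ Z) {X : E → E} {c : ℝ} {y : E} (hy : y ∈ U)
    (hX : DifferentiableAt ℝ X y)
    (hXZ : ∀ u, G y (fderiv ℝ X y u + Γ y u (X y)) (Z y)
      + G y u (fderiv ℝ X y (Z y) + Γ y (Z y) (X y)) = -2 * c * G y u (Z y)) (u : E) :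
    G y (bracket Z X y) u =
      -2 * c * G y u (Z y) - fderiv ℝ (fun z ↦ G z (X z) (Z z)) y u := by
  have := hXZ u
  rw [h.symm y hy u] at this
  rw [h.bracket_eq hy, h.fderiv_metric_field hy hX, map_add _ _ (_ • _), map_add _ _ (X y),
    map_smul]
  simp only [add_apply, smul_apply, smul_eq_mul]
  rw [h.symm y hy (Z y) u]
  linarith

theorem fderiv_metric_field_self (h : IsKenmotsuOn U G Γ Z) {X : E → E} {c : ℝ} {y : E}
    (hy : y ∈ U) (hX : DifferentiableAt ℝ X y)
    (hXZ : ∀ u, G y (fderiv ℝ X y u + Γ y u (X y)) (Z y)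
      + G y u (fderiv ℝ X y (Z y) + Γ y (Z y) (X y)) = -2 * c * G y u (Z y)) :
    fderiv ℝ (fun z ↦ G z (X z) (Z z)) y (Z y) = c := by
  have := hXZ (Z y)
  rw [h.symm y hy (Z y) (_ + _), h.unit y hy] at this
  rw [h.fderiv_metric_field hy hX, h.unit y hy]
  linarith

/-- With W = [Z, X], the 1-form W♭ is closed, so G(∇_Z W, u) = G(∇_u W, Z). The right side follows
by differentiating G(W, Z) = c, which gives ∇_Z W = W + cZ; `bracket_eq` doubles this. -/
theorem bracket_bracket (h : IsKenmotsuOn U G Γ Z) {X : E → E} {c : ℝ}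
    (hX : ∀ y ∈ U, ContDiffAt ℝ ∞ X y)
    (hXZ : ∀ y ∈ U, ∀ u, G y (fderiv ℝ X y u + Γ y u (X y)) (Z y)
      + G y u (fderiv ℝ X y (Z y) + Γ y (Z y) (X y)) = -2 * c * G y u (Z y))
    {y : E} (hy : y ∈ U) :
    bracket Z (bracket Z X) y = (2 : ℝ) • bracket Z X y + (2 * c) • Z y := by
  have hd : ∀ z ∈ U, DifferentiableAt ℝ X z := fun z hz ↦ (hX z hz).differentiableAt (by simp)
  set W := bracket Z X with hW
  set f : E → ℝ := fun z ↦ G z (X z) (Z z) with hf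
  have sW : ContDiffAt ℝ ∞ W y := contDiffAt_bracket (h.smooth_field y hy) (hX y hy)
  have dW : DifferentiableAt ℝ W y := sW.differentiableAt (by simp)
  have sf : ContDiffAt ℝ ∞ f y :=
    ((h.smooth_metric y hy).clm_apply (hX y hy)).clm_apply (h.smooth_field y hy)
  have df : DifferentiableAt ℝ (fderiv ℝ f) y :=
    (sf.fderiv_right (m := ∞) (by simp)).differentiableAt (by simp)
  have eW : ∀ z ∈ U, ∀ u, G z (W z) u = -2 * c * G z u (Z z) - fderiv ℝ f z u :=
    fun z hz u ↦ h.metric_bracket hz (hd z hz) (hXZ z hz) u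
  have eN : ∀ z ∈ U, G z (W z) (Z z) = c := by
    intro z hz
    rw [eW z hz, h.unit z hz, h.fderiv_metric_field_self hz (hd z hz) (hXZ z hz)]
    ring
  -- The derivative of W♭ = -2cν - df: both terms, the one from ∇ν and the Hessian of `f`, are
  -- symmetric in u and v.
  have eDW : ∀ v u, G y (fderiv ℝ W y v + Γ y v (W y)) u =
      2 * c * (G y v u + G y v (Z y) * G y u (Z y)) - fderiv ℝ (fderiv ℝ f) y v u
        + fderiv ℝ f y (Γ y v u) := by
    intro v u
    have e := congrArg (fun L ↦ L v) (h.fderiv_eq (fun z hz ↦ eW z hz u) hy)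
    simp only [fderiv_apply_field₂ (h.diff_metric hy) dW (differentiableAt_const u),
      fderiv_fun_sub ((h.differentiableAt_form hy u).const_mul (-2 * c))
        (df.clm_apply (differentiableAt_const u)), sub_apply,
      fderiv_const_mul (h.differentiableAt_form hy u), smul_apply, h.fderiv_form hy,
      fderiv_apply_const df, h.metric y hy, eW y hy (Γ y v u)] at e
    simp at e ⊢
    linarith
  have eZ : ∀ u, G y (fderiv ℝ W y (Z y) + Γ y (Z y) (W y)) u = G y (W y) u + c * G y u (Z y) := by
    intro u
    have e := h.fderiv_metric_field hy dW u
    rw [h.fderiv_eq_zero_of_const eN hy, eN y hy, zero_apply, eDW] at e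
    rw [eDW, h.symm y hy (Z y) u, h.torsion y hy (Z y) u, fderiv_fderiv_symm sf]
    linarith
  rw [h.bracket_eq hy, eN y hy]
  have : fderiv ℝ W y (Z y) + Γ y (Z y) (W y) = W y + c • Z y :=
    h.eq_of_metric hy fun u ↦ by rw [eZ, h.symm y hy u]; simp
  rw [this]
  module

variable [FiniteDimensional ℝ E]

theorem eq_zero_of_divergence_const (h : IsKenmotsuOn U G Γ Z) (hn : 2 ≤ Module.finrank ℝ E)
    (hU : U.Nonempty) {X : E → E} {c d : ℝ} (hX : ∀ y ∈ U, ContDiffAt ℝ ∞ X y)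
    (hdiv : ∀ y ∈ U, divergence Γ X y = d)
    (hXZ : ∀ y ∈ U, ∀ u, G y (fderiv ℝ X y u + Γ y u (X y)) (Z y)
      + G y u (fderiv ℝ X y (Z y) + Γ y (Z y) (X y)) = -2 * c * G y u (Z y)) : c = 0 := by
  obtain ⟨y, hy⟩ := hU
  have sW : ∀ z ∈ U, ContDiffAt ℝ ∞ (bracket Z X) z := fun z hz ↦
    contDiffAt_bracket (h.smooth_field z hz) (hX z hz)
  have d1 : ∀ z ∈ U, divergence Γ (bracket Z X) z = 0 := by
    intro z hz
    rw [h.divergence_bracket hz (hX z hz), h.fderiv_eq_zero_of_const hdiv hz, zero_apply]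
  have d2 : divergence Γ (bracket Z (bracket Z X)) y = 0 := by
    rw [h.divergence_bracket hy (sW y hy), h.fderiv_eq_zero_of_const d1 hy, zero_apply]
  have d3 : divergence Γ (bracket Z (bracket Z X)) y =
      2 * divergence Γ (bracket Z X) y + 2 * c * divergence Γ Z y := by
    have dW := (sW y hy).differentiableAt (by simp)
    have dZ := h.diff_field hy
    simp only [divergence]
    rw [h.fderiv_eq (fun z hz ↦ h.bracket_bracket hX hXZ hz) hy, h.bracket_bracket hX hXZ hy,
      fderiv_fun_add (dW.fun_const_smul _) (dZ.fun_const_smul _), fderiv_fun_const_smul dW,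
      fderiv_fun_const_smul dZ]
    simp only [map_add, map_smul, smul_eq_mul]
    ring
  rw [d2, d1 y hy, h.divergence_field hy] at d3
  have hn' : (2 : ℝ) ≤ Module.finrank ℝ E := by exact_mod_cast hn
  have : c * (1 - (Module.finrank ℝ E : ℝ)) = 0 := by linarith
  rcases mul_eq_zero.1 this with h0 | h0
  · exact h0
  · linarith

/-- The soliton constant of a Lorentzian para-Kenmotsu metric of constant scalar curvature:
if `£_X G + 2 s S + 2 m G = 0`, then the scalar curvature is `n (n - 1)` and `m = -s (n - 1)`. -/
theorem soliton_const (h : IsKenmotsuOn U G Γ Z) (hn : 2 ≤ Module.finrank ℝ E)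
    (hU : U.Nonempty) {A : E → E →L[ℝ] E} (hA : ∀ y ∈ U, DifferentiableAt ℝ A y)
    (hAric : ∀ y ∈ U, ∀ v w, G y (A y v) w = ric Γ y v w) {r : ℝ}
    (hr : ∀ y ∈ U, tr E (A y) = r) {X : E → E} (hX : ∀ y ∈ U, ContDiffAt ℝ ∞ X y) {s m : ℝ}
    (hsol : ∀ y ∈ U, ∀ u v, G y (fderiv ℝ X y u + Γ y u (X y)) v
      + G y u (fderiv ℝ X y v + Γ y v (X y)) + 2 * s * ric Γ y u v + 2 * m * G y u v = 0) :
    r = Module.finrank ℝ E * (Module.finrank ℝ E - 1) ∧ m = -s * (Module.finrank ℝ E - 1) := by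
  constructor
  · obtain ⟨y, hy⟩ := hU
    have := h.fderiv_scalar hA hAric hy
    rw [h.fderiv_eq_zero_of_const hr hy, hr y hy, zero_apply] at this
    linarith
  · have hdiv : ∀ y ∈ U, divergence Γ X y = -s * r - m * Module.finrank ℝ E := by
      intro y hy
      -- B = ∇X, and the soliton equation says that its adjoint is -2sA - 2m id - B. Equating traces
      -- computes 2 div X.
      set B : E →L[ℝ] E := fderiv ℝ X y + Γ y (X y) with hB
      have hBu : ∀ u, B u = fderiv ℝ X y u + Γ y u (X y) := fun u ↦ by
        rw [h.torsion y hy u]; rfl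
      have := tr_eq_of_adjoint (G y) (h.symm y hy) (h.nondegenerate y hy)
        ((-2 * s) • A y - (2 * m) • ContinuousLinearMap.id ℝ E - B) B (fun u v ↦ by
          have := hsol y hy u v
          rw [← hBu, ← hBu, ← hAric y hy] at this
          simp
          linarith)
      simp only [map_sub, map_smul, tr_id, hr y hy, smul_eq_mul] at this
      rw [divergence, ← map_add]
      linarith
    -- The value of `c` comes from the soliton equation at v = Z together with S(u, Z) = (n - 1)G(u,
    -- Z).
    have := h.eq_zero_of_divergence_const (c := s * (Module.finrank ℝ E - 1) + m) hn hU hX hdiv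
      (fun y hy u ↦ by
        have := hsol y hy u (Z y)
        rw [h.ric_field hy] at this
        linarith)
    linarith

end IsKenmotsuOn

end Soliton

/-! ### The coordinate formulas define the Levi-Civita connection and its Ricci tensor -/

theorem isInvertible_of_nondegenerate {E : Type*} [NormedAddCommGroup E] [NormedSpace ℝ E]
    [FiniteDimensional ℝ E] {g : E →L[ℝ] E →L[ℝ] ℝ} (hn : ∀ u, (∀ v, g u v = 0) → u = 0) :
    g.IsInvertible := by
  have inj : Function.Injective (g : E →ₗ[ℝ] E →L[ℝ] ℝ) := (injective_iff_map_eq_zero _).2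
    fun u hu ↦ hn u fun v ↦ congrArg (fun L : E →L[ℝ] ℝ ↦ L v) hu
  have hd : Module.finrank ℝ E = Module.finrank ℝ (E →L[ℝ] ℝ) := by
    rw [← LinearEquiv.finrank_eq (LinearMap.toContinuousLinearMap (𝕜 := ℝ) (E := E) (F' := ℝ))]
    exact Subspace.dual_finrank_eq.symm
  exact ⟨(LinearEquiv.ofInjectiveOfFinrankEq _ inj hd).toContinuousLinearEquiv, by ext; rfl⟩

namespace Coord

variable {n : ℕ}

/-- The Christoffel symbols as a field of bilinear maps. -/
def christoffelL (G : Vec n → Vec n →L[ℝ] Vec n →L[ℝ] ℝ) (y : Vec n) :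
    Vec n →L[ℝ] Vec n →L[ℝ] Vec n :=
  (ContinuousLinearMap.compL ℝ (Vec n) (Vec n →L[ℝ] ℝ) (Vec n) (G y).inverse).comp
    ((1 / 2 : ℝ) • (fderiv ℝ G y + (fderiv ℝ G y).flip
      - ((ContinuousLinearMap.flipₗᵢ ℝ (Vec n) (Vec n) ℝ :
          (Vec n →L[ℝ] Vec n →L[ℝ] ℝ) →L[ℝ] (Vec n →L[ℝ] Vec n →L[ℝ] ℝ))).comp
        (fderiv ℝ G y).flip))

theorem christoffelL_apply (G : Vec n → Vec n →L[ℝ] Vec n →L[ℝ] ℝ) (y u v : Vec n) :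
    christoffelL G y u v = christoffel G y u v := rfl

theorem curvature_eq (G : Vec n → Vec n →L[ℝ] Vec n →L[ℝ] ℝ) {y : Vec n}
    (h : DifferentiableAt ℝ (christoffelL G) y) (u v w : Vec n) :
    curvature G y u v w = curv (christoffelL G) y u v w := by
  rw [curv_apply, ← fderiv_apply_const₂ h, ← fderiv_apply_const₂ h]
  rfl

theorem tr_eq_sum (A : Vec n →L[ℝ] Vec n) : tr (Vec n) A = ∑ i, A (stdVec i) i := by
  rw [tr_apply, LinearMap.trace_eq_matrix_trace ℝ (EuclideanSpace.basisFun (Fin n) ℝ).toBasis]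
  simp [Matrix.trace, LinearMap.toMatrix_apply]

theorem ricci_eq (G : Vec n → Vec n →L[ℝ] Vec n →L[ℝ] ℝ) {y : Vec n}
    (h : DifferentiableAt ℝ (christoffelL G) y) (v w : Vec n) :
    ricci G y v w = ric (christoffelL G) y v w := by
  rw [ric, tr_eq_sum, ricci]
  simp [curvature_eq G h, curvLeft_apply]

variable {U : Set (Vec n)} {G : Vec n → Vec n →L[ℝ] Vec n →L[ℝ] ℝ}

theorem isLeviCivitaOn (hU : IsOpen U) (hG : ∀ y ∈ U, ContDiffAt ℝ ∞ G y)
    (symm : ∀ y ∈ U, ∀ u v, G y u v = G y v u)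
    (nondeg : ∀ y ∈ U, ∀ u, (∀ v, G y u v = 0) → u = 0) :
    IsLeviCivitaOn U G (christoffelL G) := by
  -- `inverse` is zero by default on non-invertible maps, so raising an index is meaningful only
  -- after this.
  have inv : ∀ y ∈ U, (G y).IsInvertible := fun y hy ↦
    isInvertible_of_nondegenerate (nondeg y hy)
  have dG : ∀ y ∈ U, DifferentiableAt ℝ G y := fun y hy ↦ (hG y hy).differentiableAt (by simp)
  have dsymm : ∀ y ∈ U, ∀ u v w, fderiv ℝ G y u v w = fderiv ℝ G y u w v := by
    intro y hy u v w
    rw [← fderiv_apply_const₂ (dG y hy), ← fderiv_apply_const₂ (dG y hy)]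
    exact congrArg (fun L : Vec n →L[ℝ] ℝ ↦ L u) (Filter.EventuallyEq.fderiv_eq
      (Filter.eventuallyEq_of_mem (hU.mem_nhds hy) fun z hz ↦ symm z hz v w))
  -- The Koszul formula for constant fields; torsion-freeness and metric compatibility are read off
  -- from it.
  have lower : ∀ y ∈ U, ∀ u v w, G y (christoffelL G y u v) w =
      1 / 2 * (fderiv ℝ G y u v w + fderiv ℝ G y v u w - fderiv ℝ G y w u v) := by
    intro y hy u v w
    rw [christoffelL_apply, christoffel, (inv y hy).self_apply_inverse]
    rfl
  refine ⟨hU, hG, fun y hy ↦ ?_, symm, nondeg, fun y hy u v ↦ ?_, fun y hy u v w ↦ ?_⟩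
  · have d1 : ContDiffAt ℝ ∞ (fderiv ℝ G) y := (hG y hy).fderiv_right (by simp)
    have d2 : ContDiffAt ℝ ∞ (fun z ↦ (fderiv ℝ G z).flip) y :=
      (ContinuousLinearMap.flipₗᵢ ℝ (Vec n) (Vec n) (Vec n →L[ℝ] ℝ)).contDiff.contDiffAt.comp y d1
    have d3 : ContDiffAt ℝ ∞ (fun z ↦ (G z).inverse) y :=
      ((inv y hy).contDiffAt_map_inverse).comp y (hG y hy)
    unfold christoffelL
    exact (contDiffAt_const.clm_apply d3).clm_comp
      (contDiffAt_const.fun_smul ((d1.add d2).sub (contDiffAt_const.clm_comp d2)))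
  · refine sub_eq_zero.1 (nondeg y hy _ fun w ↦ ?_)
    rw [map_sub, sub_apply, lower y hy, lower y hy, dsymm y hy w u v]
    ring
  · rw [symm y hy v, lower y hy, lower y hy, dsymm y hy u v w, dsymm y hy v u w,
      dsymm y hy w u v]
    ring

theorem lieDeriv_eq (h : IsLeviCivitaOn U G (christoffelL G)) {y : Vec n} (hy : y ∈ U)
    (K : Vec n → Vec n) (u v : Vec n) :
    lieDeriv G K y u v = G y (fderiv ℝ K y u + christoffelL G y u (K y)) v
      + G y u (fderiv ℝ K y v + christoffelL G y v (K y)) := by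
  rw [lieDeriv, h.metric y hy, h.torsion y hy (K y) u, h.torsion y hy (K y) v]
  simp
  ring

/-- The Ricci endomorphism `v ↦ S(v, ·)♯`. -/
def ricciEnd (G : Vec n → Vec n →L[ℝ] Vec n →L[ℝ] ℝ) (y : Vec n) : Vec n →L[ℝ] Vec n :=
  ∑ i : Fin n, ∑ j : Fin n, ric (christoffelL G) y (stdVec i) (stdVec j) •
    (EuclideanSpace.proj i : Vec n →L[ℝ] ℝ).smulRight ((G y).inverse (EuclideanSpace.proj j))

theorem ric_eq_sum (Γ : Vec n → Vec n →L[ℝ] Vec n →L[ℝ] Vec n) (y v w : Vec n) :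
    ric Γ y v w = ∑ i, ∑ j, v i * w j * ric Γ y (stdVec i) (stdVec j) := by
  have hs : ∀ x : Vec n, x = ∑ i, x i • stdVec i := fun x ↦ by
    simpa using ((EuclideanSpace.basisFun (Fin n) ℝ).sum_repr x).symm
  have addl : ∀ (s : Finset (Fin n)) (w : Vec n),
      ric Γ y (∑ i ∈ s, v i • stdVec i) w = ∑ i ∈ s, v i * ric Γ y (stdVec i) w := by
    intro s w
    have : (curvLeft Γ (∑ i ∈ s, v i • stdVec i) y).flip w =
        ∑ i ∈ s, v i • (curvLeft Γ (stdVec i) y).flip w := by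
      ext1 u
      simp only [ContinuousLinearMap.flip_apply, curvLeft_apply, sum_apply,
        smul_apply]
      -- `curvLeft` is bundled as linear in the first slot only, so skew symmetry carries linearity
      -- over to the second.
      rw [curv_swap, ← curvLeft_apply, map_sum, sum_apply,
        ← Finset.sum_neg_distrib]
      refine Finset.sum_congr rfl fun i _ ↦ ?_
      rw [map_smul, smul_apply, curvLeft_apply, curv_swap, smul_neg, neg_neg]
    rw [ric, this, map_sum]
    simp [ric]
  have addr : ∀ a : Vec n, ric Γ y a w = ∑ j, w j * ric Γ y a (stdVec j) := by
    intro a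
    conv_lhs => rw [ric, hs w, map_sum, map_sum]
    simp [ric]
  conv_lhs => rw [hs v, addl]
  refine Finset.sum_congr rfl fun i _ ↦ ?_
  rw [addr, Finset.mul_sum]
  exact Finset.sum_congr rfl fun j _ ↦ by ring

theorem metric_ricciEnd (h : IsLeviCivitaOn U G (christoffelL G)) {y : Vec n} (hy : y ∈ U)
    (v w : Vec n) : G y (ricciEnd G y v) w = ric (christoffelL G) y v w := by
  have inv := isInvertible_of_nondegenerate (h.nondegenerate y hy)
  rw [ric_eq_sum, ricciEnd]
  simp only [sum_apply, smul_apply, ContinuousLinearMap.smulRight_apply,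
    map_sum, map_smul, inv.self_apply_inverse]
  refine Finset.sum_congr rfl fun i _ ↦ Finset.sum_congr rfl fun j _ ↦ ?_
  simp
  ring

theorem differentiableAt_ricciEnd (h : IsLeviCivitaOn U G (christoffelL G)) {y : Vec n}
    (hy : y ∈ U) : DifferentiableAt ℝ (ricciEnd G) y := by
  have inv := isInvertible_of_nondegenerate (h.nondegenerate y hy)
  have d3 : DifferentiableAt ℝ (fun z ↦ (G z).inverse) y :=
    (((inv).contDiffAt_map_inverse (n := ∞)).comp y (h.smooth_metric y hy)).differentiableAt
      (by simp)
  unfold ricciEnd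
  refine DifferentiableAt.fun_sum fun i _ ↦ DifferentiableAt.fun_sum fun j _ ↦ ?_
  refine (h.fderiv_ric hy 0 _ _).1.fun_smul ?_
  exact (ContinuousLinearMap.smulRightL ℝ (Vec n) (Vec n)
    (EuclideanSpace.proj i)).differentiableAt.comp y (d3.clm_apply (differentiableAt_const _))

theorem tr_ricciEnd (h : IsLeviCivitaOn U G (christoffelL G)) {y : Vec n} (hy : y ∈ U) :
    tr (Vec n) (ricciEnd G y) = scalarCurvature G y := by
  have inv := isInvertible_of_nondegenerate (h.nondegenerate y hy)
  have hG : ∀ (j : Fin n) (w : Vec n), G y ((G y).inverse (EuclideanSpace.proj j)) w = w j := by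
    intro j w
    rw [inv.self_apply_inverse]; rfl
  have hs : ∀ j k, inverseMetric G y j k = inverseMetric G y k j := by
    intro j k
    unfold inverseMetric
    rw [← hG k, ← hG j, h.symm y hy]
  rw [ricciEnd, scalarCurvature]
  simp only [map_sum, map_smul, tr_smulRight, ricci_eq G (h.diff_connection hy)]
  refine Finset.sum_congr rfl fun i _ ↦ Finset.sum_congr rfl fun j _ ↦ ?_
  rw [hs, mul_comm]; rfl

/-- The coordinate version of the theorem: a Ricci-Yamabe soliton of constant scalar curvature on
an open subset of `ℝⁿ` with a Lorentzian para-Kenmotsu structure. -/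
theorem ricciYamabe_const (hn : 2 ≤ n) (hU : IsOpen U) (hne : U.Nonempty)
    {Φ : Vec n → Vec n →L[ℝ] Vec n} {Z K : Vec n → Vec n}
    (hG : ∀ y ∈ U, ContDiffAt ℝ ∞ G y) (hΦ : ∀ y ∈ U, ContDiffAt ℝ ∞ Φ y)
    (hZ : ∀ y ∈ U, ContDiffAt ℝ ∞ Z y) (hK : ∀ y ∈ U, ContDiffAt ℝ ∞ K y)
    (symm : ∀ y ∈ U, ∀ u v, G y u v = G y v u)
    (nondeg : ∀ y ∈ U, ∀ u, (∀ v, G y u v = 0) → u = 0)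
    (unit : ∀ y ∈ U, G y (Z y) (Z y) = -1) (hΦZ : ∀ y ∈ U, Φ y (Z y) = 0)
    (hνΦ : ∀ y ∈ U, ∀ u, G y (Φ y u) (Z y) = 0)
    (sq : ∀ y ∈ U, ∀ u, Φ y (Φ y u) = u + G y u (Z y) • Z y)
    (cov : ∀ y ∈ U, ∀ u v, covDerivEnd G Φ y u v =
      -(G y (Φ y u) v) • Z y - G y v (Z y) • Φ y u)
    {r Λ σ ρ : ℝ} (hr : ∀ y ∈ U, scalarCurvature G y = r)
    (hsol : ∀ y ∈ U, ∀ u v, lieDeriv G K y u v + 2 * σ * ricci G y u v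
      + (2 * Λ - ρ * scalarCurvature G y) * G y u v = 0) :
    Λ = ρ * n * (n - 1) / 2 - σ * (n - 1) := by
  have h := isLeviCivitaOn hU hG symm nondeg
  have hk := h.isKenmotsuOn hZ (fun y hy ↦ (hΦ y hy).differentiableAt (by simp)) unit hΦZ hνΦ sq cov
  -- The choice of `m` makes 2m = 2Λ - ρr.
  obtain ⟨h1, h2⟩ := hk.soliton_const (A := ricciEnd G) (r := r) (X := K) (s := σ)
    (m := Λ - ρ * r / 2) (by simpa using hn) hne
    (fun y hy ↦ differentiableAt_ricciEnd h hy) (fun y hy ↦ metric_ricciEnd h hy)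
    (fun y hy ↦ by rw [tr_ricciEnd h hy, hr y hy]) hK
    (fun y hy u v ↦ by
      have := hsol y hy u v
      rw [lieDeriv_eq h hy, ricci_eq G (h.diff_connection hy), hr y hy] at this
      linarith)
  rw [finrank_euclideanSpace_fin] at h1 h2
  rw [h1] at h2
  linarith

end Coord

/-! ### Coordinate frames as tangent bundle trivializations; smoothness of components -/

section Charts

variable {n : ℕ} {M : Type*} [TopologicalSpace M] [ChartedSpace (Vec n) M]

theorem extChartAt_symm_mem_source {p : M} {y : Vec n} (hy : y ∈ (extChartAt (𝓡 n) p).target) :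
    (extChartAt (𝓡 n) p).symm y ∈ (chartAt (Vec n) p).source := by
  rw [← extChartAt_source (𝓡 n)]
  exact (extChartAt (𝓡 n) p).map_target hy

variable [IsManifold (𝓡 n) ∞ M]

theorem frame_eq {p : M} {y : Vec n} (hy : y ∈ (extChartAt (𝓡 n) p).target) :
    frame p y = (trivializationAt (Vec n) (TangentSpace (𝓡 n)) p).symmL ℝ
      ((extChartAt (𝓡 n) p).symm y) := by
  have key := TangentBundle.symmL_trivializationAt (I := 𝓡 n) (extChartAt_symm_mem_source hy)
  -- Generalizing the base point avoids rewriting inside the dependent types of the tangent spaces.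
  have gen : ∀ z, z = y → (mfderivWithin (𝓡 n) (𝓡 n) (extChartAt (𝓡 n) p).symm
      (Set.range (𝓡 n)) z : Vec n →L[ℝ] Vec n) = (frame p y : Vec n →L[ℝ] Vec n) := by
    rintro _ rfl
    rw [ModelWithCorners.range_eq_univ, mfderivWithin_univ]
    rfl
  exact (key.trans (gen _ ((extChartAt (𝓡 n) p).right_inv hy))).symm

theorem frame_eq_equiv {p : M} {y : Vec n} (hy : y ∈ (extChartAt (𝓡 n) p).target) :
    frame p y = ((trivializationAt (Vec n) (TangentSpace (𝓡 n)) p).continuousLinearEquivAt ℝ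
      ((extChartAt (𝓡 n) p).symm y) (extChartAt_symm_mem_source hy)).symm := by
  rw [frame_eq hy]
  ext1 v
  exact (congrFun (Bundle.Trivialization.symm_continuousLinearEquivAt_eq
    (trivializationAt (Vec n) (TangentSpace (𝓡 n)) p) (extChartAt_symm_mem_source hy)) v).symm

theorem isInvertible_frame {p : M} {y : Vec n} (hy : y ∈ (extChartAt (𝓡 n) p).target) :
    (frame p y).IsInvertible := by
  rw [frame_eq_equiv hy]
  exact ContinuousLinearMap.isInvertible_equiv

theorem inverse_frame {p : M} {y : Vec n} (hy : y ∈ (extChartAt (𝓡 n) p).target) :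
    (frame p y).inverse = (trivializationAt (Vec n) (TangentSpace (𝓡 n)) p).continuousLinearMapAt ℝ
      ((extChartAt (𝓡 n) p).symm y) := by
  rw [frame_eq_equiv hy, ContinuousLinearMap.inverse_equiv]
  ext1 v
  exact congrFun (Bundle.Trivialization.coe_continuousLinearEquivAt_eq
    (trivializationAt (Vec n) (TangentSpace (𝓡 n)) p) (extChartAt_symm_mem_source hy)) v

/-- Common source of smoothness for the components of vector fields, endomorphism fields and
metrics: each is a bundle section read in the trivialization at `p`. -/
theorem contDiffAt_section {F : Type*} [NormedAddCommGroup F] [NormedSpace ℝ F] {V : M → Type*}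
    [∀ x, AddCommGroup (V x)] [∀ x, Module ℝ (V x)] [∀ x, TopologicalSpace (V x)]
    [TopologicalSpace (Bundle.TotalSpace F V)] [FiberBundle F V] [VectorBundle ℝ F V]
    [ContMDiffVectorBundle ∞ F V (𝓡 n)] {s : ∀ x, V x}
    (hs : ContMDiff (𝓡 n) ((𝓡 n).prod 𝓘(ℝ, F)) ∞ (fun x ↦ Bundle.TotalSpace.mk' F x (s x)))
    {p : M} {y : Vec n} (hy : y ∈ (extChartAt (𝓡 n) p).target)
    (hx : (extChartAt (𝓡 n) p).symm y ∈ (trivializationAt F V p).baseSet) :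
    ContDiffAt ℝ ∞ (fun z ↦ (trivializationAt F V p ⟨(extChartAt (𝓡 n) p).symm z,
      s ((extChartAt (𝓡 n) p).symm z)⟩).2) y := by
  have h1 := ((trivializationAt F V p).contMDiffAt_section_iff hx).1 (hs _)
  have h2 : ContMDiffAt (𝓡 n) (𝓡 n) ∞ (extChartAt (𝓡 n) p).symm y :=
    (contMDiffOn_extChartAt_symm p).contMDiffAt ((isOpen_extChartAt_target p).mem_nhds hy)
  exact (h1.comp y h2).contDiffAt

theorem contDiffAt_coordVec {X : ∀ x : M, TangentSpace (𝓡 n) x} (hX : SmoothVectorField X)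
    {p : M} {y : Vec n} (hy : y ∈ (extChartAt (𝓡 n) p).target) :
    ContDiffAt ℝ ∞ (coordVec X p) y := by
  refine (contDiffAt_section hX hy (extChartAt_symm_mem_source hy)).congr_of_eventuallyEq ?_
  filter_upwards [(isOpen_extChartAt_target p).mem_nhds hy] with z hz
  rw [coordVec, inverse_frame hz, Bundle.Trivialization.continuousLinearMapAt_apply,
    Bundle.Trivialization.linearMapAt_apply]
  exact if_pos (extChartAt_symm_mem_source hz)

theorem contDiffAt_coordEnd {φ : ∀ x : M, TangentSpace (𝓡 n) x →L[ℝ] TangentSpace (𝓡 n) x}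
    (hφ : SmoothEnd φ) {p : M} {y : Vec n} (hy : y ∈ (extChartAt (𝓡 n) p).target) :
    ContDiffAt ℝ ∞ (coordEnd φ p) y := by
  refine (contDiffAt_section hφ hy ⟨extChartAt_symm_mem_source hy,
    extChartAt_symm_mem_source hy⟩).congr_of_eventuallyEq ?_
  filter_upwards [(isOpen_extChartAt_target p).mem_nhds hy] with z hz
  rw [coordEnd, inverse_frame hz, frame_eq hz]
  rfl

theorem contDiffAt_coordBilin (g : LorentzianMetric n M) {p : M} {y : Vec n}
    (hy : y ∈ (extChartAt (𝓡 n) p).target) : ContDiffAt ℝ ∞ (coordBilin g.inner p) y := by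
  refine (contDiffAt_section g.contMDiff hy ⟨extChartAt_symm_mem_source hy,
    extChartAt_symm_mem_source hy, Set.mem_univ _⟩).congr_of_eventuallyEq ?_
  filter_upwards [(isOpen_extChartAt_target p).mem_nhds hy] with z hz
  have hx := extChartAt_symm_mem_source hz
  ext1 v
  ext1 w
  rw [coordBilin_apply, frame_eq hz, hom_trivializationAt_apply]
  refine (Eq.trans (inCoordinates_apply_eq₂ (F₃ := ℝ) (E₃ := fun _ : M ↦ ℝ) hx hx
    (Set.mem_univ _)) ?_).symm
  rw [Bundle.Trivialization.symmL_apply _ hx, Bundle.Trivialization.symmL_apply _ hx]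
  simp

end Charts

/-! ### Transfer of the pointwise algebraic identities to coordinates -/

section Structure

variable {n : ℕ} {M : Type*} [TopologicalSpace M] [ChartedSpace (Vec n) M]
  [IsManifold (𝓡 n) ∞ M]

/-- A vector orthogonal to everything is orthogonal to the timelike `t`, where the form is positive
definite, yet it is null. -/
theorem LorentzianMetric.nondegenerate (g : LorentzianMetric n M) (x : M)
    (u : TangentSpace (𝓡 n) x) (hu : ∀ v, g.inner x u v = 0) : u = 0 := by
  obtain ⟨t, -, ht⟩ := g.lorentzian x
  by_contra h
  have := ht u (by rw [g.symm]; exact hu t) h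
  rw [hu u] at this
  exact lt_irrefl _ this

theorem coordBilin_nondegenerate (g : LorentzianMetric n M) {p : M} {y : Vec n}
    (hy : y ∈ (extChartAt (𝓡 n) p).target) (u : Vec n)
    (hu : ∀ v, coordBilin g.inner p y u v = 0) : u = 0 := by
  have hF := isInvertible_frame hy
  have : frame p y u = 0 := g.nondegenerate _ _ fun v ↦ by
    rw [← hF.self_apply_inverse v]
    exact hu _
  rw [← hF.inverse_apply_self u, this, map_zero]

theorem frame_coordVec (X : ∀ x : M, TangentSpace (𝓡 n) x) {p : M} {y : Vec n}
    (hy : y ∈ (extChartAt (𝓡 n) p).target) :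
    frame p y (coordVec X p y) = X ((extChartAt (𝓡 n) p).symm y) :=
  (isInvertible_frame hy).self_apply_inverse _

theorem frame_coordEnd (φ : ∀ x : M, TangentSpace (𝓡 n) x →L[ℝ] TangentSpace (𝓡 n) x) {p : M}
    {y : Vec n} (hy : y ∈ (extChartAt (𝓡 n) p).target) (u : Vec n) :
    frame p y (coordEnd φ p y u) = φ ((extChartAt (𝓡 n) p).symm y) (frame p y u) :=
  (isInvertible_frame hy).self_apply_inverse _

theorem frame_injective {p : M} {y : Vec n} (hy : y ∈ (extChartAt (𝓡 n) p).target) :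
    Function.Injective (frame p y) :=
  Function.LeftInverse.injective (isInvertible_frame hy).inverse_apply_self

end Structure

end LPK

end


/-! ### Reduction of the theorem to one chart -/

theorem theorem3p1 {n : ℕ} (hn : 2 ≤ n)
    {M : Type*} [TopologicalSpace M] [ChartedSpace (LPK.Vec n) M] [IsManifold (𝓡 n) ∞ M]
    [Nonempty M]
    (g : LPK.LorentzianMetric n M)
    (φ : ∀ x : M, TangentSpace (𝓡 n) x →L[ℝ] TangentSpace (𝓡 n) x)
    (ζ : ∀ x : M, TangentSpace (𝓡 n) x)
    (ν : ∀ x : M, TangentSpace (𝓡 n) x →L[ℝ] ℝ)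
    (hLP : LPK.IsLPKenmotsu g φ ζ ν)
    (hr : LPK.HasConstantScalarCurvature g)
    (K : ∀ x : M, TangentSpace (𝓡 n) x) (Λ σ ρ : ℝ)
    (hK : LPK.IsRicciYamabeSoliton g K Λ σ ρ) :
    Λ = ρ * n * (n - 1) / 2 - σ * (n - 1) := by
  obtain ⟨c, hc⟩ := hr
  obtain ⟨p⟩ := ‹Nonempty M›
  -- The coordinate theorem has no separate 1-form, so ν is replaced throughout by G(·, Z).
  have hν : ∀ y ∈ (extChartAt (𝓡 n) p).target, ∀ u, LPK.coordBilin g.inner p y u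
      (LPK.coordVec ζ p y) = ν _ (LPK.frame p y u) := by
    intro y hy u
    rw [LPK.coordBilin_apply, LPK.frame_coordVec ζ hy, hLP.metric_zeta]
  refine LPK.Coord.ricciYamabe_const (U := (extChartAt (𝓡 n) p).target)
    (G := LPK.coordBilin g.inner p) (Φ := LPK.coordEnd φ p) (Z := LPK.coordVec ζ p)
    (K := LPK.coordVec K p) hn (isOpen_extChartAt_target p) ⟨_, mem_extChartAt_target p⟩
    (fun y hy ↦ LPK.contDiffAt_coordBilin g hy)
    (fun y hy ↦ LPK.contDiffAt_coordEnd hLP.smooth_phi hy)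
    (fun y hy ↦ LPK.contDiffAt_coordVec hLP.smooth_zeta hy)
    (fun y hy ↦ LPK.contDiffAt_coordVec hK.smooth hy)
    (fun y hy u v ↦ g.symm _ _ _) (fun y hy ↦ LPK.coordBilin_nondegenerate g hy)
    (fun y hy ↦ ?_) (fun y hy ↦ ?_) (fun y hy u ↦ ?_) (fun y hy u ↦ ?_) (fun y hy u v ↦ ?_)
    (hc p) (hK.equation p)
  · rw [hν y hy, LPK.frame_coordVec ζ hy]
    exact eq_neg_of_add_eq_zero_left (hLP.nu_zeta _)
  · refine LPK.frame_injective hy ?_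
    rw [LPK.frame_coordEnd φ hy, LPK.frame_coordVec ζ hy, hLP.phi_zeta, map_zero]
  · rw [hν y hy, LPK.frame_coordEnd φ hy, hLP.nu_phi]
  · refine LPK.frame_injective hy ?_
    rw [LPK.frame_coordEnd φ hy, LPK.frame_coordEnd φ hy, hLP.phi_sq, map_add, map_smul,
      LPK.frame_coordVec ζ hy, hν y hy]
  · rw [hLP.covDeriv_phi p y hy, hν y hy]
    rfl
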